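/- Let $(T(t))_{t\ge 0}$ be a bounded $C_0$-semigroup on a complex Hilbert space $X$, and let $-A$ be its generator. Put $$E := i\sigma(-A)\cap\mathbb R=\{s\in\mathbb R : is\in\sigma(A)\}.$$ Assume that $E$ is compact and of spectral synthesis, and that for some $\eta\ge 0$ one has $is\in\rho(-A)$ for all real $s$ with $|s|\ge\eta$ and $$\sup_{|s|\ge\eta}\|(is+A)^{-1}\|<\infty .$$ Let $\mu$ be a complex Borel measure of finite variation on $\mathbb R_+=[0,\infty)$ whose Fourier transform $\mathcal F\mu(\xi)=\int_{0}^\infty e^{-i\xi t}\,d\mu(t)$ vanishes for every $\xi\in E$. Then $$\lim_{t\to\infty}\|T(t)\hat\mu(T)\|=0,\qquad\text{where}\quad \hat\mu(T)x=\int_0^\infty T(s)x\,d\mu(s)\quad(x\in X).$$ Here a closed set $E\subset\mathbb R$ is called of spectral synthesis if for every $f\in L^1(\mathbb R)$ whose Fourier transform $\mathcal Ff(\xi)=\int_{\mathbb R}e^{-i\xi t}f(t)\,dt$ vanishes on $E$ there is a sequence $(f_n)$ in $L^1(\mathbb R)$ with $\|f-f_n\|_{L^1}\to0$ such that each $\mathcal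 Ff_n$ vanishes in a neighbourhood of $E$. -/

import Mathlib

open Filter Topology MeasureTheory
open scoped NNReal

noncomputable section

namespace KatznelsonTzafriri

variable {X : Type*} [NormedAddCommGroup X] [NormedSpace ℂ X]

/-! ### Strongly continuous semigroups and their generators -/

variable (X) in
/-- A `C₀`-semigroup `(T(t))_{t ≥ 0}` of bounded linear operators on `X`. -/
structure C0Semigroup where
  /-- The operator `T(t)`. -/
  op : ℝ≥0 → X →L[ℂ] X
  op_zero : op 0 = ContinuousLinearMap.id ℂ X
  op_add : ∀ s t : ℝ≥0, op (s + t) = (op s).comp (op t)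
  continuous_orbit : ∀ x : X, Continuous fun t : ℝ≥0 => op t x

namespace C0Semigroup

/-- The semigroup is bounded: `sup_{t ≥ 0} ‖T(t)‖ < ∞`. -/
def IsBounded (T : C0Semigroup X) : Prop := ∃ K : ℝ, ∀ t : ℝ≥0, ‖T.op t‖ ≤ K

/-- The graph of the generator: all `(x, y)` with `(T(h)x - x) / h → y` as `h → 0+`. -/
def generatorGraph (T : C0Semigroup X) : Submodule ℂ (X × X) where
  carrier := {p | Tendsto (fun h : ℝ≥0 => ((h : ℝ) : ℂ)⁻¹ • (T.op h p.1 - p.1))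
    (𝓝[>] 0) (𝓝 p.2)}
  zero_mem' := by simp
  add_mem' := by
    intro p q hp hq
    simp only [Set.mem_ofPred_eq] at hp hq ⊢
    refine (hp.add hq).congr fun h => ?_
    rw [← smul_add, Prod.fst_add, map_add]
    congr 1
    abel
  smul_mem' := by
    intro c p hp
    simp only [Set.mem_ofPred_eq] at hp ⊢
    refine (hp.const_smul c).congr fun h => ?_
    rw [Prod.smul_fst, map_smul, ← smul_sub, smul_comm]

/-- The (infinitesimal) generator of the semigroup, an unbounded operator whose domain consists of
all `x` for which `lim_{h → 0+} (T(h)x - x) / h` exists. -/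
def generator (T : C0Semigroup X) : X →ₗ.[ℂ] X := T.generatorGraph.toLinearPMap

theorem mem_generator_graph_iff (T : C0Semigroup X) (x y : X) :
    (x, y) ∈ T.generator.graph ↔
      Tendsto (fun h : ℝ≥0 => ((h : ℝ) : ℂ)⁻¹ • (T.op h x - x)) (𝓝[>] 0) (𝓝 y) := by
  have key : T.generator.graph = T.generatorGraph := by
    apply Submodule.toLinearPMap_graph_eq
    rintro ⟨x, y⟩ hp h0
    have h0' : x = 0 := h0
    subst h0'
    have hp' : Tendsto (fun h : ℝ≥0 => ((h : ℝ) : ℂ)⁻¹ • (T.op h (0 : X) - 0))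
      (𝓝[>] 0) (𝓝 y) := hp
    simp only [map_zero, sub_zero, smul_zero] at hp'
    exact (tendsto_nhds_unique hp' tendsto_const_nhds)
  rw [key]
  rfl

end C0Semigroup

/-! ### Resolvent and spectrum of an unbounded operator -/

/-- The bounded operator `R` is `(z - B)⁻¹`, the two-sided inverse of `z - B : dom(B) → X`. -/
def IsResolventAt (B : X →ₗ.[ℂ] X) (z : ℂ) (R : X →L[ℂ] X) : Prop :=
  (∀ y : X, ∃ x : B.domain, (x : X) = R y ∧ z • (x : X) - B x = y) ∧
    ∀ x : B.domain, R (z • (x : X) - B x) = x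

/-- The resolvent set `ρ(B)`. -/
def resolventSet (B : X →ₗ.[ℂ] X) : Set ℂ := {z | ∃ R : X →L[ℂ] X, IsResolventAt B z R}

/-- The spectrum `σ(B)`. -/
def spectrum (B : X →ₗ.[ℂ] X) : Set ℂ := (resolventSet B)ᶜ

/-! ### Fourier transforms and spectral synthesis -/

/-- The Fourier transform `ξ ↦ ∫_ℝ e^{-iξt} f(t) dt` of a function on `ℝ`. -/
def fourierFun (f : ℝ → ℂ) (ξ : ℝ) : ℂ :=
  ∫ t : ℝ, Complex.exp (-(Complex.I * ξ * t)) * f t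

/-- The Fourier transform `ξ ↦ ∫_{[0,∞)} e^{-iξt} dμ(t)` of a complex measure on `[0,∞)`. -/
def fourierMeasure (μ : ComplexMeasure ℝ≥0) (ξ : ℝ) : ℂ :=
  ∫ᵛ t : ℝ≥0, Complex.exp (-(Complex.I * ξ * (t : ℝ))) ∂[ContinuousLinearMap.mul ℝ ℂ; μ]

/-- `f` is of spectral synthesis with respect to `E`: it is the `L¹`-limit of a sequence of
integrable functions whose Fourier transforms vanish in neighbourhoods of `E`. -/
def IsOfSpectralSynthesisFor (f : ℝ → ℂ) (E : Set ℝ) : Prop :=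
  ∃ g : ℕ → ℝ → ℂ, (∀ n, Integrable (g n)) ∧
    Tendsto (fun n => ∫ t : ℝ, ‖f t - g n t‖) atTop (𝓝 0) ∧
    ∀ n, ∃ U : Set ℝ, IsOpen U ∧ E ⊆ U ∧ ∀ ξ ∈ U, fourierFun (g n) ξ = 0

/-- The closed set `E` is of spectral synthesis: every `f ∈ L¹(ℝ)` whose Fourier transform vanishes
on `E` is of spectral synthesis with respect to `E`. -/
def IsOfSpectralSynthesis (E : Set ℝ) : Prop :=
  IsClosed E ∧ ∀ f : ℝ → ℂ, Integrable f → (∀ ξ ∈ E, fourierFun f ξ = 0) →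
    IsOfSpectralSynthesisFor f E

/-! ### The operator `∫ T(s) dμ(s)` -/

namespace C0Semigroup

theorem integrable_orbit (T : C0Semigroup X) (hT : T.IsBounded) (μ : ComplexMeasure ℝ≥0)
    [IsFiniteMeasure μ.variation] (x : X) : μ.Integrable fun s => T.op s x := by
  obtain ⟨K, hK⟩ := hT
  refine Integrable.of_bound (T.continuous_orbit x).aestronglyMeasurable (K * ‖x‖) ?_
  exact Eventually.of_forall fun s => (T.op s).le_of_opNorm_le (hK s) x

/-- For a bounded `C₀`-semigroup and a complex measure `μ` of finite variation on `[0,∞)`, the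
bounded operator `x ↦ ∫_{[0,∞)} T(s)x dμ(s)`. -/
def measureOp (T : C0Semigroup X) (hT : T.IsBounded) (μ : ComplexMeasure ℝ≥0)
    [IsFiniteMeasure μ.variation] : X →L[ℂ] X :=
  LinearMap.mkContinuousOfExistsBound
    { toFun := fun x =>
        ∫ᵛ s : ℝ≥0, T.op s x ∂[(ContinuousLinearMap.lsmul ℝ ℂ : ℂ →L[ℝ] X →L[ℝ] X).flip; μ]
      map_add' := by
        intro x y
        simp only [map_add]
        exact VectorMeasure.integral_fun_add (T.integrable_orbit hT μ x)
          (T.integrable_orbit hT μ y)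
      map_smul' := by
        intro c x
        simp only [map_smul, RingHom.id_apply]
        rw [VectorMeasure.integral_eq_setToFun, VectorMeasure.integral_eq_setToFun]
        refine setToFun_smul _ ?_ c _
        intro c s x
        exact smul_comm _ _ _ }
    (by
      obtain ⟨K, hK⟩ := id hT
      refine ⟨K * ‖(ContinuousLinearMap.lsmul ℝ ℂ : ℂ →L[ℝ] X →L[ℝ] X).flip‖ *
        μ.variation.real Set.univ, fun x => ?_⟩
      refine (VectorMeasure.norm_integral_le_of_norm_le_const (C := K * ‖x‖)
        (Eventually.of_forall fun s => (T.op s).le_of_opNorm_le (hK s) x)).trans (le_of_eq ?_)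
      ring)

theorem measureOp_apply (T : C0Semigroup X) (hT : T.IsBounded) (μ : ComplexMeasure ℝ≥0)
    [IsFiniteMeasure μ.variation] (x : X) :
    T.measureOp hT μ x =
      ∫ᵛ s : ℝ≥0, T.op s x ∂[(ContinuousLinearMap.lsmul ℝ ℂ : ℂ →L[ℝ] X →L[ℝ] X).flip; μ] :=
  rfl

end C0Semigroup

end KatznelsonTzafriri

end

/-! Let `B = -A` be the generator and `R(z) = (z - B)⁻¹`. The Fourier transform, with kernel
`e^{iξt}`, of `F(t) = t²/2 · e^{-at} T(t)x` on `[0,∞)` is `R(a - iξ)³x`.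

Suppose first that a finite complex measure `ν` on `ℝ` has Fourier transform `N` vanishing on a
neighbourhood `U` of `E`. Fourier inversion, made rigorous by a Gaussian factor, gives `2π ∫ F(τ +
r) dν(r) = ∫ N(ξ) e^{-iξτ} R(a - iξ)³x dξ`. Only `ξ ∉ U` matter, and there the resolvent is bounded
by some `M` uniformly in small `a > 0` (`exists_uniform_lower_bound`: compactness on a bounded part,
the hypothesis at infinity). Of the three resolvents the middle one costs `M`; the inner and outer
ones cost `O(a^{-1/2})` each by Plancherel's theorem, which is where the Hilbert space enters. Hence
the integral is `O(1/a)` uniformly in `τ` and `‖x‖ ≤ 1` (`norm_integral_gaussian_laplace_le`). Take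
`a = 1/τ` and multiply by `2/τ²`: the weight becomes `u²e^{-u}` with `u = (τ + r)/τ`, which tends
boundedly to `e^{-1}`, while the bound is `O(1/τ)`. So `∫ T(τ + r) dν(r)`, cut off to `τ + r ≥ 0`,
tends to zero in operator norm (`eventually_norm_shiftIntegral_add_le`).

For general `μ`, choose `ψ ∈ L¹` with Fourier transform `1` on a ball containing `E`. The transform
of `f = μ * ψ` vanishes on `E`, so synthesis gives `g` close to `f` in `L¹` with transform zero near
`E`. Then `ν = μ + (g - f) dt` has transform zero near `E`, and the correction costs at most `K‖g -
f‖₁`, where `‖T(t)‖ ≤ K`. -/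

namespace KatznelsonTzafriri

open scoped FourierTransform SchwartzMap

/-! ### Plancherel's theorem for Hilbert-space-valued functions -/

section Plancherel

variable {X : Type*} [NormedAddCommGroup X] [InnerProductSpace ℂ X] [CompleteSpace X]

/-- Both sides have the same pairing with every test function: the multiplication formula moves
either transform onto the test function. -/
theorem fourier_toLp_ae_eq {f : ℝ → X} (hf : Integrable f) (hf2 : MemLp f 2) :
    (𝓕 (hf2.toLp f) : Lp X 2 (volume : Measure ℝ)) =ᵐ[volume] 𝓕 f := by
  have hcont : Continuous (𝓕 f) :=
    VectorFourier.fourierIntegral_continuous Real.continuous_fourierChar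
      (by exact continuous_inner) hf
  refine ae_eq_of_integral_contDiff_smul_eq ?_ hcont.locallyIntegrable ?_
  · exact (Lp.memLp _).locallyIntegrable (by norm_num)
  intro g hg hgc
  have hg1 : HasCompactSupport (Complex.ofRealCLM ∘ g) := hgc.comp_left rfl
  have hg2 : ContDiff ℝ ((⊤ : ℕ∞) : WithTop ℕ∞) (Complex.ofRealCLM ∘ g) := by fun_prop
  set G : 𝓢(ℝ, ℂ) := hg1.toSchwartzMap hg2 with hG
  have hGa : ∀ x, G x = (g x : ℂ) := fun x => rfl
  have h1 := congrArg (fun D : 𝓢'(ℝ, X) => D G)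
    (Lp.fourier_toTemperedDistribution_eq (hf2.toLp f))
  simp only [TemperedDistribution.fourier_apply, Lp.toTemperedDistribution_apply] at h1
  have h2 : ∫ x, g x • (𝓕 (hf2.toLp f) : Lp X 2 (volume : Measure ℝ)) x
      = ∫ x, G x • (𝓕 (hf2.toLp f) : Lp X 2 (volume : Measure ℝ)) x := by
    simp [hGa]
  have h3 : ∫ x, g x • 𝓕 f x = ∫ x, G x • 𝓕 f x := by simp [hGa]
  rw [h2, h3, ← h1]
  have h4 := VectorFourier.integral_fourierIntegral_smul_eq_flip (L := innerₗ ℝ)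
    (μ := (volume : Measure ℝ)) (ν := (volume : Measure ℝ)) (f := G) (g := f)
    Real.continuous_fourierChar (by exact continuous_inner) G.integrable hf
  have h5 : ∫ x, (𝓕 G : 𝓢(ℝ, ℂ)) x • (hf2.toLp f) x = ∫ x, (𝓕 (G : ℝ → ℂ)) x • f x := by
    refine integral_congr_ae ?_
    filter_upwards [hf2.coeFn_toLp] with x hx
    rw [hx, SchwartzMap.fourier_coe]
  rw [h5]
  simpa using! h4

theorem integral_norm_sq_fourier {f : ℝ → X} (hf : Integrable f) (hf2 : MemLp f 2) :
    MemLp (𝓕 f) 2 ∧ ∫ w, ‖𝓕 f w‖ ^ 2 = ∫ t, ‖f t‖ ^ 2 := by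
  have h := fourier_toLp_ae_eq hf hf2
  have hm : MemLp (𝓕 f) 2 := (memLp_congr_ae h).1 (Lp.memLp _)
  refine ⟨hm, ?_⟩
  have h1 := Lp.norm_fourier_eq (hf2.toLp f)
  have key : ∀ {u : ℝ → X} (hu : MemLp u 2), ∫ t, ‖u t‖ ^ 2 = ‖hu.toLp u‖ ^ 2 := by
    intro u hu
    rw [Lp.norm_toLp, hu.eLpNorm_eq_integral_rpow_norm (by norm_num) (by norm_num),
      ENNReal.toReal_ofReal (by positivity)]
    simp only [ENNReal.toReal_ofNat, Real.rpow_ofNat]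
    rw [← Real.rpow_natCast, ← Real.rpow_mul (integral_nonneg fun _ => by positivity)]
    norm_num
  rw [key hm, key hf2, ← h1]
  congr 2
  ext1
  exact hm.coeFn_toLp.trans h.symm

/-- Plancherel's theorem with the kernel `e^{iξt}`. -/
theorem integral_norm_sq_integral_exp_smul {f : ℝ → X} (hf : Integrable f) (hf2 : MemLp f 2) :
    Integrable (fun ξ : ℝ => ‖∫ t : ℝ, Complex.exp (Complex.I * ξ * t) • f t‖ ^ 2) ∧
    ∫ ξ : ℝ, ‖∫ t : ℝ, Complex.exp (Complex.I * ξ * t) • f t‖ ^ 2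
      = 2 * Real.pi * ∫ t, ‖f t‖ ^ 2 := by
  obtain ⟨h1, h2⟩ := integral_norm_sq_fourier hf hf2
  have hpi := Real.pi_pos
  -- The kernel of `𝓕` is `e^{-2πiwt}`; the substitution `w = -ξ/(2π)` produces the factor `2π`.
  have e : ∀ ξ : ℝ, ∫ t : ℝ, Complex.exp (Complex.I * ξ * t) • f t
      = 𝓕 f ((-(2 * Real.pi)⁻¹) * ξ) := by
    intro ξ
    rw [Real.fourier_real_eq_integral_exp_smul]
    congr with t
    congr 2
    push_cast
    field_simp
  simp only [e]
  refine ⟨?_, ?_⟩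
  · exact Integrable.comp_mul_left' (g := fun w => ‖𝓕 f w‖ ^ 2)
      ((memLp_two_iff_integrable_sq_norm h1.1).1 h1) (by simp [hpi.ne'])
  · rw [Measure.integral_comp_mul_left (fun w => ‖𝓕 f w‖ ^ 2), h2]
    rw [smul_eq_mul, inv_neg, inv_inv, abs_neg, abs_of_pos (by positivity)]

end Plancherel

/-! ### Complex measures as densities against their variation -/

section Density

variable {Ω : Type*} [MeasurableSpace Ω]

/-- Polar decomposition of a complex measure of finite variation. -/
theorem exists_density (μ : ComplexMeasure Ω) [IsFiniteMeasure μ.variation] :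
    ∃ h : Ω → ℂ, Integrable h μ.variation ∧ (∀ᵐ ω ∂μ.variation, ‖h ω‖ = 1) ∧
      μ.variation.withDensityᵥ h = μ := by
  set m := μ.variation with hm
  have hac : ∀ s, m s = 0 → μ s = 0 := by
    intro s hs
    have := VectorMeasure.enorm_measure_le_variation μ s
    rw [← hm, hs] at this
    simpa using this
  have key : ∀ σ : SignedMeasure Ω, (∀ s, μ s = 0 → σ s = 0) →
      m.withDensityᵥ (σ.rnDeriv m) = σ := by
    intro σ hσ
    refine SignedMeasure.withDensityᵥ_rnDeriv_eq _ _ ?_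
    refine VectorMeasure.AbsolutelyContinuous.mk fun s hs h0 => ?_
    rw [Measure.toENNRealVectorMeasure_apply_measurable hs] at h0
    exact hσ s (hac s h0)
  have hre : ∀ s, ComplexMeasure.re μ s = (μ s).re := fun s => rfl
  have him : ∀ s, ComplexMeasure.im μ s = (μ s).im := fun s => rfl
  have keyre := key (ComplexMeasure.re μ) fun s hs => by rw [hre, hs, Complex.zero_re]
  have keyim := key (ComplexMeasure.im μ) fun s hs => by rw [him, hs, Complex.zero_im]
  set a := (ComplexMeasure.re μ).rnDeriv m
  set b := (ComplexMeasure.im μ).rnDeriv m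
  have ha : Integrable a m := SignedMeasure.integrable_rnDeriv _ _
  have hb : Integrable b m := SignedMeasure.integrable_rnDeriv _ _
  have hh : Integrable (fun ω => (a ω : ℂ) + (b ω : ℂ) * Complex.I) m :=
    ha.ofReal.add (hb.ofReal.mul_const _)
  have heq : m.withDensityᵥ (fun ω => (a ω : ℂ) + (b ω : ℂ) * Complex.I) = μ := by
    ext s hs
    have e1 : ∫ ω in s, (a ω : ℂ) + (b ω : ℂ) * Complex.I ∂m =
        ∫ ω in s, (a ω : ℂ) ∂m + ∫ ω in s, (b ω : ℂ) * Complex.I ∂m :=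
      integral_add ha.ofReal.restrict (hb.ofReal.mul_const _).restrict
    rw [withDensityᵥ_apply hh hs, e1, integral_mul_const, integral_complex_ofReal,
      integral_complex_ofReal, ← withDensityᵥ_apply ha hs, ← withDensityᵥ_apply hb hs,
      keyre, keyim, hre, him]
    exact Complex.re_add_im _
  refine ⟨_, hh, ?_, heq⟩
  -- The variation of `h · m` is `|h| · m`, but it is also `m`, which forces `|h| = 1` almost
  -- everywhere.
  have hv := Measure.variation_withDensityᵥ hh
  rw [heq, ← hm] at hv
  have h1 : m.withDensity (fun ω => ‖(a ω : ℂ) + (b ω : ℂ) * Complex.I‖ₑ) = m.withDensity 1 := by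
    rw [← hv, withDensity_one]
  have h2 := (withDensity_eq_iff hh.aestronglyMeasurable.enorm (by fun_prop)
    (by simpa [lintegral_one] using! hh.2.ne)).1 h1
  filter_upwards [h2] with ω hω
  have := congrArg ENNReal.toReal hω
  simpa using this

/-- Both sides agree on indicator functions and are continuous in `L¹`, where multiplication by the
unimodular `h` is an isometry. Vector-measure integrals can thus be replaced by Bochner integrals.
-/
theorem integral_eq_integral_density {X : Type*} [NormedAddCommGroup X] [NormedSpace ℂ X]
    [CompleteSpace X] (μ : ComplexMeasure Ω) [IsFiniteMeasure μ.variation] {h : Ω → ℂ}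
    (hh : Integrable h μ.variation) (h1 : ∀ᵐ ω ∂μ.variation, ‖h ω‖ = 1)
    (hμ : μ.variation.withDensityᵥ h = μ) (B : X →L[ℝ] ℂ →L[ℝ] X) (hB : ∀ x c, B x c = c • x)
    {f : Ω → X} (hf : Integrable f μ.variation) :
    ∫ᵛ ω, f ω ∂[B; μ] = ∫ ω, h ω • f ω ∂μ.variation := by
  have hint : ∀ {g : Ω → X}, Integrable g μ.variation →
      Integrable (fun ω => h ω • g ω) μ.variation := by
    intro g hg
    refine hg.norm.mono' (hh.1.smul hg.1) ?_
    filter_upwards [h1] with ω hω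
    rw [norm_smul, hω, one_mul]
  refine hf.induction (P := fun f => ∫ᵛ ω, f ω ∂[B; μ] = ∫ ω, h ω • f ω ∂μ.variation) ?_ ?_ ?_ ?_
  · intro c s hs _
    rw [VectorMeasure.integral_indicator_const c hs, hB]
    have : (fun ω => h ω • s.indicator (fun _ => c) ω) = s.indicator fun ω => h ω • c := by
      ext ω
      by_cases hω : ω ∈ s <;> simp [hω]
    rw [this, integral_indicator hs, integral_smul_const, ← withDensityᵥ_apply hh hs, hμ]
  · intro f g _ hf hg hPf hPg
    rw [VectorMeasure.integral_add hf hg, hPf, hPg, ← integral_add (hint hf) (hint hg)]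
    simp
  · refine isClosed_eq VectorMeasure.continuous_integral ?_
    refine continuous_iff_continuousAt.2 fun f => ?_
    refine tendsto_integral_of_L1 _ (hint (L1.integrable_coeFn f)).1
      (Eventually.of_forall fun g => hint (L1.integrable_coeFn g)) ?_
    have : Tendsto (fun g : Ω →₁[μ.variation] X => edist g f) (𝓝 f) (𝓝 0) := by
      have := (continuous_id.edist (continuous_const (y := f))).tendsto f
      simpa using this
    refine this.congr fun g => ?_
    rw [L1.edist_def]
    refine lintegral_congr_ae ?_
    filter_upwards [h1] with ω hω
    rw [← smul_sub, enorm_smul, edist_eq_enorm_sub, ← ofReal_norm (h ω), hω]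
    simp
  · intro f g hfg hf hP
    rw [← VectorMeasure.integral_congr_ae hfg, hP]
    refine integral_congr_ae ?_
    filter_upwards [hfg] with ω hω
    rw [hω]

end Density

/-! ### Orbits and the action of the generator on weighted orbit integrals -/

namespace C0Semigroup

variable {X : Type*} [NormedAddCommGroup X] [NormedSpace ℂ X]

/-- The orbit `t ↦ T(t)x`, extended to negative times by the constant `x`. -/
noncomputable def orbit (T : C0Semigroup X) (x : X) (t : ℝ) : X := T.op t.toNNReal x

theorem orbit_zero (T : C0Semigroup X) (x : X) : T.orbit x 0 = x := by
  simp [orbit, T.op_zero]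

theorem continuous_orbit_real (T : C0Semigroup X) (x : X) : Continuous (T.orbit x) :=
  (T.continuous_orbit x).comp continuous_real_toNNReal

theorem op_orbit (T : C0Semigroup X) (x : X) (h : ℝ≥0) {t : ℝ} (ht : 0 ≤ t) :
    T.op h (T.orbit x t) = T.orbit x (t + h) := by
  have : (t + h).toNNReal = h + t.toNNReal := by
    rw [Real.toNNReal_add ht h.coe_nonneg, Real.toNNReal_coe, add_comm]
  rw [orbit, orbit, this, T.op_add]
  rfl

theorem norm_orbit_le {T : C0Semigroup X} {K : ℝ} (hK : ∀ t, ‖T.op t‖ ≤ K) (x : X) (t : ℝ) :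
    ‖T.orbit x t‖ ≤ K * ‖x‖ :=
  (T.op _).le_of_opNorm_le (hK _) x

/-- Uniform boundedness upgrades strong continuity to joint continuity; this supplies the
measurability needed for Fubini when the vector varies with `ξ`. -/
theorem continuous_orbit_uncurry {T : C0Semigroup X} {K : ℝ} (hK : ∀ t, ‖T.op t‖ ≤ K)
    {Y : Type*} [TopologicalSpace Y] {v : Y → X} (hv : Continuous v) :
    Continuous fun p : Y × ℝ => T.orbit (v p.1) p.2 := by
  refine continuous_iff_continuousAt.2 fun ⟨y, t⟩ => ?_
  rw [ContinuousAt, tendsto_iff_norm_sub_tendsto_zero]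
  have h1 : Tendsto (fun p : Y × ℝ => K * ‖v p.1 - v y‖ + ‖T.orbit (v y) p.2 - T.orbit (v y) t‖)
      (𝓝 (y, t)) (𝓝 0) := by
    have : Continuous fun p : Y × ℝ =>
        K * ‖v p.1 - v y‖ + ‖T.orbit (v y) p.2 - T.orbit (v y) t‖ := by
      have := T.continuous_orbit_real (v y)
      fun_prop
    simpa using this.tendsto (y, t)
  refine squeeze_zero (fun _ => norm_nonneg _) (fun p => ?_) h1
  have : T.orbit (v p.1) p.2 - T.orbit (v y) t =
      T.orbit (v p.1 - v y) p.2 + (T.orbit (v y) p.2 - T.orbit (v y) t) := by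
    simp [orbit, map_sub]
  rw [this]
  exact (norm_add_le _ _).trans (add_le_add_left (norm_orbit_le hK _ _) _)

theorem integrableOn_smul_orbit {T : C0Semigroup X} {K : ℝ} (hK : ∀ t, ‖T.op t‖ ≤ K)
    {φ : ℝ → ℂ} (hφc : Continuous φ) {C c : ℝ} (hc : 0 < c)
    (hφ : ∀ t, 0 ≤ t → ‖φ t‖ ≤ C * Real.exp (-c * t)) (x : X) :
    IntegrableOn (fun t => φ t • T.orbit x t) (Set.Ioi 0) := by
  refine Integrable.mono' ((exp_neg_integrableOn_Ioi 0 hc).const_mul (C * (K * ‖x‖)))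
    (hφc.smul (T.continuous_orbit_real x)).aestronglyMeasurable ?_
  refine (ae_restrict_iff' measurableSet_Ioi).2 (Eventually.of_forall fun t ht => ?_)
  rw [norm_smul]
  calc ‖φ t‖ * ‖T.orbit x t‖ ≤ (C * Real.exp (-c * t)) * (K * ‖x‖) :=
        mul_le_mul (hφ t (le_of_lt ht)) (norm_orbit_le hK x t) (norm_nonneg _)
          ((norm_nonneg _).trans (hφ t (le_of_lt ht)))
    _ = _ := by ring

/-- The generator acts on `∫₀^∞ φ(t)T(t)x dt` by differentiating `φ`. -/
theorem integral_smul_orbit_mem_generatorGraph [CompleteSpace X] {T : C0Semigroup X} {K : ℝ}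
    (hK : ∀ t, ‖T.op t‖ ≤ K) {φ φ' : ℝ → ℂ} (hd : ∀ t, HasDerivAt φ (φ' t) t)
    {C c : ℝ} (hc : 0 < c)
    (hφ : ∀ t, 0 ≤ t → ‖φ t‖ ≤ C * Real.exp (-c * t))
    (hφ' : ∀ t, 0 ≤ t → ‖φ' t‖ ≤ C * Real.exp (-c * t)) (x : X) :
    (∫ t in Set.Ioi (0 : ℝ), φ t • T.orbit x t,
      -(∫ t in Set.Ioi (0 : ℝ), φ' t • T.orbit x t) - φ 0 • x) ∈ T.generatorGraph := by
  have hφc : Continuous φ := continuous_iff_continuousAt.2 fun t => (hd t).continuousAt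
  have hoc := T.continuous_orbit_real x
  have hI := integrableOn_smul_orbit hK hφc hc hφ x
  have hC : 0 ≤ C := by
    have := (norm_nonneg _).trans (hφ 0 le_rfl)
    simpa using this
  have hK0 : 0 ≤ K := (norm_nonneg _).trans (hK 0)
  have hshift : ∀ h : ℝ≥0, IntegrableOn (fun t => φ (t - h) • T.orbit x t) (Set.Ioi (h : ℝ)) := by
    intro h
    refine Integrable.mono' ((exp_neg_integrableOn_Ioi (h : ℝ) hc).const_mul
        (C * Real.exp (c * h) * (K * ‖x‖)))
      ((hφc.comp (by fun_prop)).smul hoc).aestronglyMeasurable ?_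
    refine (ae_restrict_iff' measurableSet_Ioi).2 (Eventually.of_forall fun t ht => ?_)
    rw [norm_smul]
    have h0 : 0 ≤ t - h := sub_nonneg.2 (le_of_lt ht)
    calc ‖φ (t - h)‖ * ‖T.orbit x t‖ ≤ (C * Real.exp (-c * (t - h))) * (K * ‖x‖) :=
          mul_le_mul (hφ _ h0) (norm_orbit_le hK x t) (norm_nonneg _) (by positivity)
      _ = _ := by
        rw [show -c * (t - h) = c * h + -c * t by ring, Real.exp_add]
        ring
  -- With `I` the integral, `(T(h)I - I)/h` splits into the integral over `t > h` of `(φ(t-h) -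
  -- φ(t))/h · T(t)x`, which tends to `-∫ φ'(t)T(t)x dt`, minus the average of `φ(t)T(t)x` over
  -- `[0,h]`, which tends to `φ(0)x`.
  have hop : ∀ h : ℝ≥0, T.op h (∫ t in Set.Ioi (0 : ℝ), φ t • T.orbit x t) =
      ∫ t in Set.Ioi (h : ℝ), φ (t - h) • T.orbit x t := by
    intro h
    rw [← ContinuousLinearMap.integral_comp_comm _ hI]
    have e : ∫ t in Set.Ioi (h : ℝ), φ (t - h) • T.orbit x t =
        ∫ t in Set.Ioi (0 : ℝ), φ t • T.orbit x (t + h) := by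
      rw [← integral_indicator measurableSet_Ioi, ← integral_indicator measurableSet_Ioi,
        ← integral_add_right_eq_self _ (h : ℝ)]
      refine integral_congr_ae (Eventually.of_forall fun t => ?_)
      by_cases ht : 0 < t
      · simp [Set.indicator, ht]
      · simp [Set.indicator, ht]
    rw [e]
    refine setIntegral_congr_fun measurableSet_Ioi fun t ht => ?_
    simp only [map_smul]
    rw [op_orbit _ _ _ (le_of_lt ht)]
  have hsplit : ∀ h : ℝ≥0, ∫ t in Set.Ioi (0 : ℝ), φ t • T.orbit x t =
      (∫ t in (0 : ℝ)..h, φ t • T.orbit x t) + ∫ t in Set.Ioi (h : ℝ), φ t • T.orbit x t := by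
    intro h
    rw [intervalIntegral.integral_of_le h.coe_nonneg, ← setIntegral_union _ measurableSet_Ioi
      (hI.mono_set fun t ht => ht.1) (hI.mono_set fun t ht => lt_of_le_of_lt h.coe_nonneg ht),
      Set.Ioc_union_Ioi_eq_Ioi h.coe_nonneg]
    exact Set.Ioc_disjoint_Ioi le_rfl
  have hcoe : Tendsto (fun h : ℝ≥0 => (h : ℝ)) (𝓝[>] 0) (𝓝[>] 0) := by
    refine tendsto_nhdsWithin_of_tendsto_nhds_of_eventually_within _ ?_ ?_
    · exact (NNReal.continuous_coe.tendsto' 0 0 rfl).mono_left nhdsWithin_le_nhds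
    · filter_upwards [self_mem_nhdsWithin] with h hh
      exact NNReal.coe_pos.2 hh
  have t1 : Tendsto (fun h : ℝ≥0 => ((h : ℝ) : ℂ)⁻¹ • ∫ t in (0 : ℝ)..h, φ t • T.orbit x t)
      (𝓝[>] 0) (𝓝 (φ 0 • x)) := by
    have hF : HasDerivAt (fun u => ∫ t in (0 : ℝ)..u, φ t • T.orbit x t) (φ 0 • x) 0 := by
      have := (hφc.smul hoc).integral_hasStrictDerivAt 0 0
      simpa [orbit_zero] using! this.hasDerivAt
    have h2 := (hasDerivAt_iff_tendsto_slope_zero.1 hF).mono_left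
      (nhdsWithin_mono (0 : ℝ) (show Set.Ioi (0 : ℝ) ⊆ {0}ᶜ from fun t ht => ne_of_gt ht))
    refine (h2.comp hcoe).congr fun h => ?_
    simp only [Function.comp_apply, zero_add, intervalIntegral.integral_same, sub_zero]
    rw [← Complex.ofReal_inv, Complex.coe_smul]
  have t2 : Tendsto (fun h : ℝ≥0 => ∫ t in Set.Ioi (0 : ℝ), (Set.Ioi (h : ℝ)).indicator
      (fun t => (((h : ℝ) : ℂ)⁻¹ * (φ (t - h) - φ t)) • T.orbit x t) t) (𝓝[>] 0)
      (𝓝 (∫ t in Set.Ioi (0 : ℝ), (-φ' t) • T.orbit x t)) := by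
    refine tendsto_integral_filter_of_dominated_convergence
      (fun t => (C * Real.exp c * (K * ‖x‖)) * Real.exp (-c * t)) ?_ ?_ ?_ ?_
    · refine Eventually.of_forall fun h => ?_
      refine (Continuous.aestronglyMeasurable ?_).indicator measurableSet_Ioi
      fun_prop
    · have : ∀ᶠ h : ℝ≥0 in 𝓝[>] 0, h < 1 :=
        nhdsWithin_le_nhds (Iio_mem_nhds one_pos)
      filter_upwards [self_mem_nhdsWithin, this] with h (hh : 0 < h) hh1
      refine Eventually.of_forall fun t => ?_
      by_cases ht : (h : ℝ) < t
      swap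
      · rw [Set.indicator_of_notMem (by simpa using ht), norm_zero]
        positivity
      rw [Set.indicator_of_mem (by simpa using ht), norm_smul, norm_mul, norm_inv]
      have hh' : (0 : ℝ) < h := hh
      -- The mean value inequality on `[t-h, t]`; restricting to `h < 1` makes the dominating
      -- function independent of `h`.
      have hmv : ‖φ (t - h) - φ t‖ ≤ (C * Real.exp (-c * (t - h))) * ‖(t - h) - t‖ := by
        refine (convex_Icc (t - h) t).norm_image_sub_le_of_norm_hasDerivWithin_le
          (f' := φ') (fun s _ => (hd s).hasDerivWithinAt) (fun s hs => ?_)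
          (Set.right_mem_Icc.2 (by linarith)) (Set.left_mem_Icc.2 (by linarith))
        refine (hφ' s (by linarith [hs.1])).trans ?_
        gcongr C * ?_
        exact Real.exp_le_exp.2 (by nlinarith [hs.1])
      have hexp : Real.exp (-c * (t - h)) ≤ Real.exp c * Real.exp (-c * t) := by
        rw [← Real.exp_add]
        have : (h : ℝ) < 1 := hh1
        exact Real.exp_le_exp.2 (by nlinarith)
      have hn : ‖((h : ℝ) : ℂ)‖⁻¹ * ‖φ (t - h) - φ t‖ ≤ C * (Real.exp c * Real.exp (-c * t)) := by
        rw [Complex.norm_real, Real.norm_of_nonneg hh'.le, inv_mul_le_iff₀ hh']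
        refine hmv.trans ?_
        rw [show (t - h) - t = -(h : ℝ) by ring, norm_neg, Real.norm_of_nonneg hh'.le, mul_comm]
        gcongr
      calc _ ≤ (C * (Real.exp c * Real.exp (-c * t))) * (K * ‖x‖) :=
            mul_le_mul hn (norm_orbit_le hK x t) (norm_nonneg _) (by positivity)
        _ = _ := by ring
    · exact (exp_neg_integrableOn_Ioi 0 hc).const_mul _
    · refine (ae_restrict_iff' measurableSet_Ioi).2 (Eventually.of_forall fun t ht => ?_)
      have h3 : Tendsto (fun h : ℝ≥0 => ((h : ℝ) : ℂ)⁻¹ * (φ (t - h) - φ t)) (𝓝[>] 0)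
          (𝓝 (-φ' t)) := by
        have hneg : HasDerivAt (fun s => φ (t - s)) (-φ' t) 0 := by
          have := (hd (t - 0)).comp_const_sub t 0
          simpa using! this
        have h2 := (hasDerivAt_iff_tendsto_slope_zero.1 hneg).mono_left
          (nhdsWithin_mono (0 : ℝ) (show Set.Ioi (0 : ℝ) ⊆ {0}ᶜ from fun t ht => ne_of_gt ht))
        refine (h2.comp hcoe).congr fun h => ?_
        simp [Complex.real_smul]
      refine (h3.smul_const (T.orbit x t)).congr' ?_
      have : ∀ᶠ h : ℝ≥0 in 𝓝[>] 0, (h : ℝ) < t :=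
        (hcoe.mono_right nhdsWithin_le_nhds).eventually (Iio_mem_nhds ht)
      filter_upwards [this] with h hh
      rw [Set.indicator_of_mem (by simpa using hh)]
  have t3 := t2.sub t1
  simp only [neg_smul, integral_neg] at t3
  refine t3.congr' ?_
  filter_upwards [self_mem_nhdsWithin] with h (hh : 0 < h)
  rw [hop h, hsplit h, setIntegral_indicator measurableSet_Ioi,
    Set.inter_eq_right.2 (Set.Ioi_subset_Ioi h.coe_nonneg)]
  have hIh := hI.mono_set (Set.Ioi_subset_Ioi h.coe_nonneg)
  have e : ∫ t in Set.Ioi (h : ℝ), (((h : ℝ) : ℂ)⁻¹ * (φ (t - h) - φ t)) • T.orbit x t =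
      ((h : ℝ) : ℂ)⁻¹ • (∫ t in Set.Ioi (h : ℝ), φ (t - h) • T.orbit x t -
        φ t • T.orbit x t) := by
    rw [← integral_smul]
    refine integral_congr_ae (Eventually.of_forall fun t => ?_)
    simp only [mul_smul, sub_smul]
  rw [e, integral_sub (hshift h) hIh]
  rw [← smul_sub]
  congr 1
  abel

end C0Semigroup

/-! ### The kernels `tᵏe^{-at}/k!` on the half-line -/

section Kernel

/-- The function `t ↦ tᵏ e^{-at} / k!` on `[0,∞)`, extended by zero. -/
noncomputable def expKernel (k : ℕ) (a t : ℝ) : ℝ :=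
  (Set.Ici (0 : ℝ)).indicator (fun t => t ^ k / k.factorial * Real.exp (-a * t)) t

theorem expKernel_nonneg (k : ℕ) (a t : ℝ) : 0 ≤ expKernel k a t := by
  refine Set.indicator_nonneg (fun t ht => ?_) t
  have : (0 : ℝ) ≤ t := ht
  positivity

theorem measurable_expKernel (k : ℕ) (a : ℝ) : Measurable (expKernel k a) :=
  (Continuous.measurable (by fun_prop)).indicator measurableSet_Ici

/-- Half of the exponential decay absorbs the power, by `sᵏ/k! ≤ eˢ` at `s = at/2`. -/
theorem pow_div_factorial_mul_exp_le (k : ℕ) {a : ℝ} (ha : 0 < a) {t : ℝ} (ht : 0 ≤ t) :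
    t ^ k / k.factorial * Real.exp (-a * t) ≤ (2 / a) ^ k * Real.exp (-(a / 2) * t) := by
  have h := Real.pow_div_factorial_le_exp (a / 2 * t) (by positivity) k
  have e : t ^ k / k.factorial = (2 / a) ^ k * ((a / 2 * t) ^ k / k.factorial) := by
    rw [mul_pow, div_pow, div_pow]
    field_simp
  have e2 : Real.exp (-(a / 2) * t) = Real.exp (a / 2 * t) * Real.exp (-a * t) := by
    rw [← Real.exp_add]
    ring_nf
  rw [e, e2, mul_assoc]
  gcongr

theorem expKernel_le (k : ℕ) {a : ℝ} (ha : 0 < a) (t : ℝ) :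
    expKernel k a t ≤ (Set.Ici (0 : ℝ)).indicator
      (fun t => (2 / a) ^ k * Real.exp (-(a / 2) * t)) t :=
  Set.indicator_le_indicator' fun ht => pow_div_factorial_mul_exp_le k ha ht

theorem integrable_expKernel (k : ℕ) {a : ℝ} (ha : 0 < a) : Integrable (expKernel k a) := by
  have h : Integrable ((Set.Ici (0 : ℝ)).indicator
      (fun t => (2 / a) ^ k * Real.exp (-(a / 2) * t))) := by
    rw [integrable_indicator_iff measurableSet_Ici, integrableOn_Ici_iff_integrableOn_Ioi]
    exact (exp_neg_integrableOn_Ioi 0 (by positivity)).const_mul _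
  refine h.mono' (measurable_expKernel k a).aestronglyMeasurable (Eventually.of_forall fun t => ?_)
  rw [Real.norm_of_nonneg (expKernel_nonneg k a t)]
  exact expKernel_le k ha t

theorem continuous_expKernel_succ (k : ℕ) (a : ℝ) : Continuous (expKernel (k + 1) a) := by
  refine continuous_indicator ?_ (by fun_prop)
  intro t ht
  rw [frontier_Ici] at ht
  have : t = 0 := ht
  simp [this]

theorem expKernel_zero_sq (a t : ℝ) : expKernel 0 a t ^ 2 = expKernel 0 (2 * a) t := by
  by_cases ht : t ∈ Set.Ici (0 : ℝ)
  · simp only [expKernel, Set.indicator_of_mem ht, pow_zero, Nat.factorial_zero, Nat.cast_one,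
      div_one, one_mul]
    rw [← Real.exp_nat_mul]
    push_cast
    ring_nf
  · simp [expKernel, Set.indicator_of_notMem ht]

theorem integral_expKernel_zero {a : ℝ} (ha : 0 < a) : ∫ t, expKernel 0 a t = 1 / a := by
  unfold expKernel
  rw [integral_indicator measurableSet_Ici, integral_Ici_eq_integral_Ioi]
  simp only [pow_zero, Nat.factorial_zero, Nat.cast_one, div_one, one_mul]
  rw [integral_exp_mul_Ioi (neg_lt_zero.2 ha)]
  simp

end Kernel

/-! ### Powers of the resolvent as Laplace integrals -/

namespace C0Semigroup

variable {X : Type*} [NormedAddCommGroup X] [NormedSpace ℂ X]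

theorem norm_expKernel_smul_orbit_le {T : C0Semigroup X} {K : ℝ} (hK : ∀ t, ‖T.op t‖ ≤ K)
    (k : ℕ) (a : ℝ) (x : X) (t : ℝ) :
    ‖(expKernel k a t : ℂ) • T.orbit x t‖ ≤ expKernel k a t * (K * ‖x‖) := by
  rw [norm_smul, Complex.norm_real, Real.norm_of_nonneg (expKernel_nonneg k a t)]
  exact mul_le_mul_of_nonneg_left (norm_orbit_le hK x t) (expKernel_nonneg k a t)

theorem aestronglyMeasurable_expKernel_smul_orbit (T : C0Semigroup X) (k : ℕ) (a : ℝ) (x : X) :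
    AEStronglyMeasurable (fun t => (expKernel k a t : ℂ) • T.orbit x t) volume :=
  (Complex.measurable_ofReal.comp (measurable_expKernel k a)).aestronglyMeasurable.smul
    (T.continuous_orbit_real x).aestronglyMeasurable

theorem integrable_expKernel_smul_orbit {T : C0Semigroup X} {K : ℝ} (hK : ∀ t, ‖T.op t‖ ≤ K)
    (k : ℕ) {a : ℝ} (ha : 0 < a) (x : X) :
    Integrable fun t => (expKernel k a t : ℂ) • T.orbit x t :=
  ((integrable_expKernel k ha).mul_const (K * ‖x‖)).mono'
    (T.aestronglyMeasurable_expKernel_smul_orbit k a x)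
    (Eventually.of_forall fun t => norm_expKernel_smul_orbit_le hK k a x t)

/-- The integral `∫₀^∞ tᵏ/k! e^{-(a-iξ)t} T(t)x dt`, which is the `(k+1)`-st power of the
resolvent of the generator at `a - iξ`, applied to `x`. -/
noncomputable def laplace (T : C0Semigroup X) (k : ℕ) (a ξ : ℝ) (x : X) : X :=
  ∫ t : ℝ, Complex.exp (Complex.I * ξ * t) • ((expKernel k a t : ℂ) • T.orbit x t)

theorem norm_exp_I_mul_mul (ξ t : ℝ) : ‖Complex.exp (Complex.I * ξ * t)‖ = 1 := by
  rw [mul_assoc, ← Complex.ofReal_mul, mul_comm, Complex.norm_exp_ofReal_mul_I]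

theorem continuous_laplace {T : C0Semigroup X} {K : ℝ} (hK : ∀ t, ‖T.op t‖ ≤ K)
    (k : ℕ) {a : ℝ} (ha : 0 < a) (x : X) : Continuous fun ξ => T.laplace k a ξ x := by
  refine continuous_of_dominated (fun ξ => ?_) (fun ξ => Eventually.of_forall fun t => ?_)
    (integrable_expKernel_smul_orbit hK k ha x).norm (Eventually.of_forall fun t => ?_)
  · exact (Continuous.aestronglyMeasurable (by fun_prop)).smul
      (T.aestronglyMeasurable_expKernel_smul_orbit k a x)
  · rw [norm_smul, norm_exp_I_mul_mul, one_mul]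
  · fun_prop

theorem laplace_smul (T : C0Semigroup X) (k : ℕ) (a ξ : ℝ) (c : ℂ) (x : X) :
    T.laplace k a ξ (c • x) = c • T.laplace k a ξ x := by
  unfold laplace
  rw [← integral_smul]
  congr with t
  simp only [orbit, map_smul, smul_smul]
  congr 1
  ring

theorem laplace_eq_integral_Ioi (T : C0Semigroup X) (k : ℕ) (a ξ : ℝ) (x : X) :
    T.laplace k a ξ x = ∫ t in Set.Ioi (0 : ℝ),
      ((t : ℂ) ^ k / k.factorial * Complex.exp (-((a : ℂ) - Complex.I * ξ) * t)) • T.orbit x t := by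
  rw [← integral_Ici_eq_integral_Ioi, ← integral_indicator measurableSet_Ici, laplace]
  congr with t
  by_cases ht : t ∈ Set.Ici (0 : ℝ)
  · rw [Set.indicator_of_mem ht, expKernel, Set.indicator_of_mem ht, smul_smul]
    congr 1
    push_cast
    rw [mul_left_comm, ← Complex.exp_add]
    ring_nf
  · rw [Set.indicator_of_notMem ht, expKernel, Set.indicator_of_notMem ht]
    simp

theorem norm_exp_neg_mul (a ξ t : ℝ) :
    ‖Complex.exp (-((a : ℂ) - Complex.I * ξ) * t)‖ = Real.exp (-a * t) := by
  rw [Complex.norm_exp]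
  simp

theorem norm_laplace_kernel_le (k : ℕ) {a : ℝ} (ha : 0 < a) (ξ : ℝ) {t : ℝ} (ht : 0 ≤ t) :
    ‖(t : ℂ) ^ k / k.factorial * Complex.exp (-((a : ℂ) - Complex.I * ξ) * t)‖ ≤
      (2 / a) ^ k * Real.exp (-(a / 2) * t) := by
  rw [norm_mul, norm_exp_neg_mul, norm_div, norm_pow, Complex.norm_natCast, Complex.norm_real,
    Real.norm_of_nonneg ht]
  exact pow_div_factorial_mul_exp_le k ha ht

variable [CompleteSpace X]

/-- The case `φ(t) = e^{-zt}`, `z = a - iξ`: the boundary term `φ(0)x = x` shows that the Laplace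
integral is a right inverse of `z - B`. -/
theorem laplace_zero_mem {T : C0Semigroup X} {K : ℝ} (hK : ∀ t, ‖T.op t‖ ≤ K)
    {a : ℝ} (ha : 0 < a) (ξ : ℝ) (x : X) :
    (T.laplace 0 a ξ x, ((a : ℂ) - Complex.I * ξ) • T.laplace 0 a ξ x - x) ∈
      T.generatorGraph := by
  set z := (a : ℂ) - Complex.I * ξ with hz
  have hb : ∀ t : ℝ, 0 ≤ t → ‖Complex.exp (-z * t)‖ ≤ Real.exp (-(a / 2) * t) := by
    intro t ht
    have h := norm_laplace_kernel_le 0 ha ξ ht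
    rw [← hz] at h
    simpa only [pow_zero, Nat.factorial_zero, Nat.cast_one, div_one, one_mul] using h
  have hc : 0 ≤ ‖z‖ := norm_nonneg _
  have h := integral_smul_orbit_mem_generatorGraph hK (φ := fun t : ℝ => Complex.exp (-z * t))
    (φ' := fun t : ℝ => -z * Complex.exp (-z * t)) (C := 1 + ‖z‖) (c := a / 2)
    (fun t => ?_) (by positivity) (fun t ht => ?_) (fun t ht => ?_) x
  · have e : T.laplace 0 a ξ x =
        ∫ t in Set.Ioi (0 : ℝ), Complex.exp (-z * t) • T.orbit x t := by
      rw [laplace_eq_integral_Ioi]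
      simp [hz]
    rw [e]
    convert! h using 2
    simp [mul_smul, integral_neg, integral_smul]
  · have h1 : HasDerivAt (fun t : ℝ => -z * (t : ℂ)) (-z) t := by
      simpa using (Complex.ofRealCLM.hasDerivAt (x := t)).const_mul (-z)
    simpa [mul_comm] using! h1.cexp
  · refine (hb t ht).trans ?_
    nlinarith [Real.exp_pos (-(a / 2) * t)]
  · rw [norm_mul, norm_neg]
    nlinarith [Real.exp_pos (-(a / 2) * t), hb t ht, norm_nonneg (Complex.exp (-z * t))]

/-- For `φ_k(t) = tᵏe^{-zt}/k!` one has `φ_{k+1}' = φ_k - zφ_{k+1}`, and `φ_{k+1}(0) = 0` removes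
the boundary term. So `z - B` lowers the power by one. -/
theorem laplace_succ_mem {T : C0Semigroup X} {K : ℝ} (hK : ∀ t, ‖T.op t‖ ≤ K)
    (k : ℕ) {a : ℝ} (ha : 0 < a) (ξ : ℝ) (x : X) :
    (T.laplace (k + 1) a ξ x,
      ((a : ℂ) - Complex.I * ξ) • T.laplace (k + 1) a ξ x - T.laplace k a ξ x) ∈
      T.generatorGraph := by
  set z := (a : ℂ) - Complex.I * ξ with hz
  set φ : ℕ → ℝ → ℂ := fun k t => (t : ℂ) ^ k / k.factorial * Complex.exp (-z * t) with hφ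
  have hφc : ∀ k, Continuous (φ k) := fun k => by fun_prop
  have hb : ∀ (k : ℕ) (t : ℝ), 0 ≤ t → ‖φ k t‖ ≤ (2 / a) ^ k * Real.exp (-(a / 2) * t) :=
    fun k t ht => norm_laplace_kernel_le k ha ξ ht
  have hI : ∀ k, IntegrableOn (fun t => φ k t • T.orbit x t) (Set.Ioi 0) := fun k =>
    integrableOn_smul_orbit hK (hφc k) (half_pos ha) (hb k) x
  have e : ∀ k, T.laplace k a ξ x = ∫ t in Set.Ioi (0 : ℝ), φ k t • T.orbit x t :=
    fun k => T.laplace_eq_integral_Ioi k a ξ x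
  have h := integral_smul_orbit_mem_generatorGraph hK (φ := φ (k + 1))
    (φ' := fun t : ℝ => φ k t - z * φ (k + 1) t)
    (C := (2 / a) ^ k + (1 + ‖z‖) * (2 / a) ^ (k + 1)) (c := a / 2)
    (fun t => ?_) (half_pos ha) (fun t ht => ?_) (fun t ht => ?_) x
  · rw [e, e]
    have e2 : ∫ t in Set.Ioi (0 : ℝ), (φ k t - z * φ (k + 1) t) • T.orbit x t =
        (∫ t in Set.Ioi (0 : ℝ), φ k t • T.orbit x t) -
          z • ∫ t in Set.Ioi (0 : ℝ), φ (k + 1) t • T.orbit x t := by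
      have h3 : IntegrableOn (fun t => z • φ (k + 1) t • T.orbit x t) (Set.Ioi 0) :=
        (hI (k + 1)).smul z
      rw [← integral_smul, ← integral_sub (hI k) h3]
      congr with t
      simp only [sub_smul, mul_smul]
    rw [e2] at h
    have h0 : φ (k + 1) 0 = 0 := by simp [hφ]
    rw [h0, zero_smul, sub_zero, neg_sub] at h
    exact h
  · have h1 : HasDerivAt (fun t : ℝ => -z * (t : ℂ)) (-z) t := by
      simpa using (Complex.ofRealCLM.hasDerivAt (x := t)).const_mul (-z)
    have h2 : HasDerivAt (fun t : ℝ => (t : ℂ) ^ (k + 1) / ((k + 1).factorial : ℂ))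
        ((t : ℂ) ^ k / k.factorial) t := by
      have := ((Complex.ofRealCLM.hasDerivAt (x := t)).pow (k + 1)).div_const
        ((k + 1).factorial : ℂ)
      refine this.congr_deriv ?_
      have hk : (k.factorial : ℂ) ≠ 0 := by exact_mod_cast k.factorial_ne_zero
      have hk1 : (k : ℂ) + 1 ≠ 0 := by exact_mod_cast k.succ_ne_zero
      simp only [Nat.factorial_succ, Complex.ofRealCLM_apply, add_tsub_cancel_right]
      push_cast
      field_simp
    refine (h2.mul h1.cexp).congr_deriv ?_
    simp only [hφ]
    ring
  · refine (hb (k + 1) t ht).trans ?_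
    gcongr
    have h1 : (0 : ℝ) ≤ (2 / a) ^ k := by positivity
    have h2 : (0 : ℝ) ≤ (2 / a) ^ (k + 1) := by positivity
    nlinarith [norm_nonneg z]
  · refine (norm_sub_le _ _).trans ?_
    rw [norm_mul z]
    have h1 := hb k t ht
    have h2 := mul_le_mul_of_nonneg_left (hb (k + 1) t ht) (norm_nonneg z)
    have h3 : 0 ≤ (2 / a) ^ (k + 1) * Real.exp (-(a / 2) * t) := by positivity
    nlinarith

end C0Semigroup

/-! ### Uniform lower bounds near the imaginary axis -/

section LowerBound

variable {X : Type*} [NormedAddCommGroup X] [NormedSpace ℂ X]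

/-- Replacing `z` by `z'` costs at most `‖x‖/2`, which the left side absorbs. Arguing with lower
bounds on the graph avoids constructing perturbed resolvents. -/
theorem norm_le_of_norm_sub_le {M : ℝ} {z z' : ℂ} {x y : X} (h : ‖x‖ ≤ M * ‖z • x - y‖)
    (hM : 0 ≤ M) (hz : M * ‖z - z'‖ ≤ 1 / 2) : ‖x‖ ≤ 2 * M * ‖z' • x - y‖ := by
  have h1 : ‖z • x - y‖ ≤ ‖z' • x - y‖ + ‖z - z'‖ * ‖x‖ := by
    rw [← norm_smul]
    refine le_trans (le_of_eq ?_) (norm_add_le _ _)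
    rw [sub_smul]
    congr 1
    abel
  nlinarith [mul_le_mul_of_nonneg_left h1 hM, norm_nonneg x,
    mul_le_mul_of_nonneg_right hz (norm_nonneg x)]

/-- Resolvent bounds on the part of the imaginary axis outside an open set extend to a thin strip
to its right. -/
theorem exists_uniform_lower_bound (G : Set (X × X)) {U : Set ℝ} (hU : IsOpen U)
    (hloc : ∀ ξ ∉ U, ∃ M : ℝ, ∀ x y, (x, y) ∈ G → ‖x‖ ≤ M * ‖(-(Complex.I * ξ)) • x - y‖)
    {C η : ℝ} (hinf : ∀ ξ : ℝ, η ≤ |ξ| → ∀ x y, (x, y) ∈ G →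
      ‖x‖ ≤ C * ‖(-(Complex.I * ξ)) • x - y‖) :
    ∃ M : ℝ, 0 < M ∧ ∃ a₀ : ℝ, 0 < a₀ ∧ ∀ a : ℝ, 0 < a → a ≤ a₀ → ∀ ξ ∉ U, ∀ x y,
      (x, y) ∈ G → ‖x‖ ≤ M * ‖((a : ℂ) - Complex.I * ξ) • x - y‖ := by
  have hcomp : IsCompact (Set.Icc (-η) η \ U) := isCompact_Icc.diff hU
  obtain ⟨M₁, hM₁, hM₁b⟩ : ∃ M : ℝ, 0 < M ∧ ∀ ξ ∈ Set.Icc (-η) η \ U, ∀ x y, (x, y) ∈ G →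
      ‖x‖ ≤ M * ‖(-(Complex.I * ξ)) • x - y‖ := by
    refine hcomp.induction_on (p := fun s => ∃ M : ℝ, 0 < M ∧ ∀ ξ ∈ s, ∀ x y, (x, y) ∈ G →
      ‖x‖ ≤ M * ‖(-(Complex.I * ξ)) • x - y‖) ?_ ?_ ?_ ?_
    · exact ⟨1, one_pos, by simp⟩
    · rintro s t hst ⟨M, hM, h⟩
      exact ⟨M, hM, fun ξ hξ => h ξ (hst hξ)⟩
    · rintro s t ⟨M, hM, h⟩ ⟨M', hM', h'⟩
      refine ⟨max M M', lt_max_of_lt_left hM, fun ξ hξ x y hxy => ?_⟩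
      rcases hξ with hξ | hξ
      · exact (h ξ hξ x y hxy).trans (by gcongr; exact le_max_left _ _)
      · exact (h' ξ hξ x y hxy).trans (by gcongr; exact le_max_right _ _)
    · intro ξ hξ
      obtain ⟨M, hM⟩ := hloc ξ hξ.2
      set M' := max M 1
      have hM'1 : 1 ≤ M' := le_max_right _ _
      -- The radius makes `M'|ξ' - ξ| ≤ 1/2`; the same threshold later gives `a₀ = 1/(2M)`.
      refine ⟨Metric.ball ξ (1 / (2 * M')) ∩ (Set.Icc (-η) η \ U),
        inter_mem (mem_nhdsWithin_of_mem_nhds (Metric.ball_mem_nhds ξ (by positivity)))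
          self_mem_nhdsWithin, 2 * M', by positivity, fun ξ' hξ' x y hxy => ?_⟩
      have h1 : ‖x‖ ≤ M' * ‖(-(Complex.I * ξ)) • x - y‖ :=
        (hM x y hxy).trans (by gcongr; exact le_max_left _ _)
      refine norm_le_of_norm_sub_le h1 (by positivity) ?_
      have h2 : ‖-(Complex.I * ξ) - -(Complex.I * ξ')‖ = dist ξ' ξ := by
        rw [show -(Complex.I * ξ) - -(Complex.I * ξ') = Complex.I * ((ξ' - ξ : ℝ) : ℂ) by
          push_cast; ring, norm_mul, Complex.norm_I, one_mul, Complex.norm_real, dist_eq_norm]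
      rw [h2]
      have h3 : dist ξ' ξ < 1 / (2 * M') := hξ'.1
      rw [lt_div_iff₀ (by positivity)] at h3
      linarith
  set M := max M₁ C with hMdef
  have hM : 0 < M := lt_max_of_lt_left hM₁
  refine ⟨2 * M, by positivity, 1 / (2 * M), by positivity, fun a ha ha' ξ hξ x y hxy => ?_⟩
  have h1 : ‖x‖ ≤ M * ‖(-(Complex.I * ξ)) • x - y‖ := by
    by_cases h : η ≤ |ξ|
    · exact (hinf ξ h x y hxy).trans (by gcongr; exact le_max_right _ _)
    · refine (hM₁b ξ ⟨abs_le.1 (not_le.1 h).le, hξ⟩ x y hxy).trans ?_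
      gcongr
      exact le_max_left _ _
  refine norm_le_of_norm_sub_le h1 hM.le ?_
  rw [show -(Complex.I * ξ) - (a - Complex.I * ξ) = -(a : ℂ) by ring, norm_neg, Complex.norm_real,
    Real.norm_of_nonneg ha.le]
  rw [le_div_iff₀ (by positivity)] at ha'
  linarith

end LowerBound

/-! ### Plancherel estimates for integrals of resolvent powers -/

namespace C0Semigroup

variable {X : Type*} [NormedAddCommGroup X] [InnerProductSpace ℂ X] [CompleteSpace X]

/-- Plancherel applied to `e^{-at}T(t)x`, whose squared norm is at most `(K‖x‖)²e^{-2at}`; the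
latter exponential has integral `1/(2a)`. -/
theorem integral_norm_sq_laplace_zero_le {T : C0Semigroup X} {K : ℝ} (hK : ∀ t, ‖T.op t‖ ≤ K)
    {a : ℝ} (ha : 0 < a) (x : X) :
    Integrable (fun ξ => ‖T.laplace 0 a ξ x‖ ^ 2) ∧
    ∫ ξ, ‖T.laplace 0 a ξ x‖ ^ 2 ≤ 2 * Real.pi * ((K * ‖x‖) ^ 2 * (1 / (2 * a))) := by
  set f : ℝ → X := fun t => (expKernel 0 a t : ℂ) • T.orbit x t with hf
  have hfi : Integrable f := integrable_expKernel_smul_orbit hK 0 ha x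
  have hb : ∀ t, ‖f t‖ ^ 2 ≤ (K * ‖x‖) ^ 2 * expKernel 0 (2 * a) t := by
    intro t
    rw [← expKernel_zero_sq, ← mul_pow, mul_comm]
    exact pow_le_pow_left₀ (norm_nonneg _) (norm_expKernel_smul_orbit_le hK 0 a x t) 2
  have hbi : Integrable fun t => (K * ‖x‖) ^ 2 * expKernel 0 (2 * a) t :=
    (integrable_expKernel 0 (by positivity)).const_mul _
  have hsq : Integrable fun t => ‖f t‖ ^ 2 := by
    refine hbi.mono' (hfi.1.norm.pow 2) (Eventually.of_forall fun t => ?_)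
    rw [Real.norm_of_nonneg (by positivity)]
    exact hb t
  obtain ⟨h1, h2⟩ := integral_norm_sq_integral_exp_smul hfi
    ((memLp_two_iff_integrable_sq_norm hfi.1).2 hsq)
  refine ⟨h1, h2.trans_le ?_⟩
  gcongr
  rw [← integral_expKernel_zero (show 0 < 2 * a by positivity), ← integral_const_mul]
  exact integral_mono hsq hbi hb

/-- Both sides are sent by `z - B` to `T.laplace 1 a ξ x`, and the lower bound makes `z - B`
injective. -/
theorem laplace_two_eq {T : C0Semigroup X} {K : ℝ} (hK : ∀ t, ‖T.op t‖ ≤ K)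
    {a : ℝ} (ha : 0 < a) {M ξ : ℝ} (hlow : ∀ x y, (x, y) ∈ T.generatorGraph →
      ‖x‖ ≤ M * ‖((a : ℂ) - Complex.I * ξ) • x - y‖) (x : X) :
    T.laplace 2 a ξ x = T.laplace 0 a ξ (T.laplace 1 a ξ x) := by
  have h1 := laplace_succ_mem hK 1 ha ξ x
  have h2 := laplace_zero_mem hK ha ξ (T.laplace 1 a ξ x)
  have h3 := hlow _ _ (T.generatorGraph.sub_mem h1 h2)
  rw [show ((a : ℂ) - Complex.I * ξ) • (T.laplace (1 + 1) a ξ x -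
    T.laplace 0 a ξ (T.laplace 1 a ξ x)) - (((a : ℂ) - Complex.I * ξ) • T.laplace (1 + 1) a ξ x
      - T.laplace 1 a ξ x - (((a : ℂ) - Complex.I * ξ) • T.laplace 0 a ξ (T.laplace 1 a ξ x) -
        T.laplace 1 a ξ x)) = 0 by rw [smul_sub]; abel, norm_zero, mul_zero] at h3
  exact sub_eq_zero.1 (norm_le_zero_iff.1 h3)

/-- The integral of `R(a-iξ)v(ξ)` over `ξ`, by Plancherel's theorem. -/
theorem norm_integral_laplace_zero_le {T : C0Semigroup X} {K : ℝ} (hK : ∀ t, ‖T.op t‖ ≤ K)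
    {a : ℝ} (ha : 0 < a) {v : ℝ → X} (hvc : Continuous v) (hvi : Integrable v)
    (hv2 : MemLp v 2) :
    ‖∫ ξ, T.laplace 0 a ξ (v ξ)‖ ≤
      K / 2 * (1 / (2 * a) + 2 * Real.pi * ∫ ξ, ‖v ξ‖ ^ 2) := by
  have hK0 : 0 ≤ K := (norm_nonneg _).trans (hK 0)
  obtain ⟨hp1, hp2⟩ := integral_norm_sq_integral_exp_smul hvi hv2
  set w : ℝ → X := fun t => ∫ ξ : ℝ, Complex.exp (Complex.I * t * ξ) • v ξ with hw
  have hint : Integrable (Function.uncurry fun ξ t : ℝ => Complex.exp (Complex.I * ξ * t) •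
      ((expKernel 0 a t : ℂ) • T.orbit (v ξ) t)) (volume.prod volume) := by
    refine Integrable.mono' ((hvi.norm.mul_prod (integrable_expKernel 0 ha)).const_mul K) ?_ ?_
    · refine (Continuous.aestronglyMeasurable (by fun_prop)).smul
        (AEStronglyMeasurable.smul ?_ ?_)
      · exact (Complex.measurable_ofReal.comp
          ((measurable_expKernel 0 a).comp measurable_snd)).aestronglyMeasurable
      · exact (continuous_orbit_uncurry hK hvc).aestronglyMeasurable
    · refine Eventually.of_forall fun p => ?_
      simp only [Function.uncurry]
      rw [norm_smul, norm_exp_I_mul_mul, one_mul]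
      refine (norm_expKernel_smul_orbit_le hK 0 a _ _).trans (le_of_eq ?_)
      ring
  -- Since `T(t)` does not depend on `ξ`, Fubini lets it act on the Fourier transform `w(t)` of `v`,
  -- to which Plancherel applies.
  have hswap : ∫ ξ, T.laplace 0 a ξ (v ξ) =
      ∫ t, (expKernel 0 a t : ℂ) • T.orbit (w t) t := by
    simp only [laplace]
    rw [integral_integral_swap hint]
    congr with t
    have e : ∀ ξ : ℝ, Complex.exp (Complex.I * ξ * t) •
        ((expKernel 0 a t : ℂ) • T.orbit (v ξ) t) =
        (expKernel 0 a t : ℂ) • (T.op t.toNNReal) (Complex.exp (Complex.I * t * ξ) • v ξ) := by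
      intro ξ
      rw [map_smul, orbit, smul_comm, mul_right_comm]
    simp only [e]
    rw [integral_smul, ContinuousLinearMap.integral_comp_comm]
    · rfl
    · refine hvi.norm.mono' ((Continuous.aestronglyMeasurable (by fun_prop)).smul hvi.1)
        (Eventually.of_forall fun ξ => ?_)
      rw [norm_smul, norm_exp_I_mul_mul, one_mul]
  rw [hswap, ← integral_expKernel_zero (show 0 < 2 * a by positivity), ← hp2,
    ← integral_add (integrable_expKernel 0 (by positivity)) hp1, ← integral_const_mul]
  refine norm_integral_le_of_norm_le
    (((integrable_expKernel 0 (by positivity)).add hp1).const_mul _)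
    (Eventually.of_forall fun t => ?_)
  refine (norm_expKernel_smul_orbit_le hK 0 a _ _).trans ?_
  rw [← expKernel_zero_sq]
  -- The inequality `2pq ≤ p² + q²` replaces Cauchy–Schwarz; nothing is lost in order, as both terms
  -- will be `O(1/a)`.
  have := mul_nonneg hK0 (sq_nonneg (expKernel 0 a t - ‖w t‖))
  simp only [hw] at this ⊢
  nlinarith

/-- The core estimate. On the support of `N` the third power factors as outer, middle and inner
resolvent: the middle one is bounded by `M`, the other two are handled by Plancherel. The bound
depends on neither `b` nor `τ`, so the Gaussian can be removed afterwards. -/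
theorem norm_integral_gaussian_laplace_le {T : C0Semigroup X} {K : ℝ} (hK : ∀ t, ‖T.op t‖ ≤ K)
    {N : ℝ → ℂ} (hNc : Continuous N) {B : ℝ} (hB : ∀ ξ, ‖N ξ‖ ≤ B) {M a : ℝ} (ha : 0 < a)
    (hM : 0 ≤ M) (hlow : ∀ ξ, N ξ ≠ 0 → ∀ x y, (x, y) ∈ T.generatorGraph →
      ‖x‖ ≤ M * ‖((a : ℂ) - Complex.I * ξ) • x - y‖) {b : ℝ} (hb : 0 < b) (τ : ℝ)
    {x : X} (hx : ‖x‖ ≤ 1) :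
    ‖∫ ξ : ℝ, (Complex.exp (-b * ξ ^ 2) * N ξ * Complex.exp (-(Complex.I * ξ * τ))) •
      T.laplace 2 a ξ x‖ ≤
      K / 2 * (1 / 2 + 2 * Real.pi * ((B * M) ^ 2 * (2 * Real.pi * (K ^ 2 / 2)))) / a := by
  have hK0 : 0 ≤ K := (norm_nonneg _).trans (hK 0)
  have hB0 : 0 ≤ B := (norm_nonneg _).trans (hB 0)
  set g : ℝ → ℂ := fun ξ =>
    Complex.exp (-b * ξ ^ 2) * N ξ * Complex.exp (-(Complex.I * ξ * τ)) with hg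
  set v : ℝ → X := fun ξ => g ξ • T.laplace 1 a ξ x with hv
  have hvc : Continuous v := by
    have h1 := continuous_laplace hK 1 ha x
    fun_prop
  have hgn : ∀ ξ, ‖g ξ‖ = Real.exp (-b * ξ ^ 2) * ‖N ξ‖ := by
    intro ξ
    have h1 : ‖Complex.exp (-(Complex.I * ξ * τ))‖ = 1 := by
      rw [Complex.exp_neg, norm_inv, norm_exp_I_mul_mul, inv_one]
    have h2 : ‖Complex.exp (-b * ξ ^ 2)‖ = Real.exp (-b * ξ ^ 2) := by
      rw [Complex.norm_exp]
      norm_cast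
    simp only [hg]
    rw [norm_mul, norm_mul, h1, h2, mul_one]
  have hgB : ∀ ξ, ‖g ξ‖ ≤ B * Real.exp (-b * ξ ^ 2) := by
    intro ξ
    rw [hgn, mul_comm]
    gcongr
    exact hB ξ
  have hexp1 : ∀ ξ : ℝ, Real.exp (-b * ξ ^ 2) ≤ 1 := by
    intro ξ
    rw [Real.exp_le_one_iff]
    nlinarith [sq_nonneg ξ]
  have hgz : ∀ ξ, N ξ = 0 → g ξ = 0 := by
    intro ξ h
    simp [hg, h]
  have hvb : ∀ ξ, ‖v ξ‖ ≤ Real.exp (-b * ξ ^ 2) * (B * M * ‖T.laplace 0 a ξ x‖) := by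
    intro ξ
    by_cases hN : N ξ = 0
    · simp only [hv, hgz ξ hN, zero_smul, norm_zero]
      positivity
    · have h1 := hlow ξ hN _ _ (laplace_succ_mem hK 0 ha ξ x)
      rw [sub_sub_cancel] at h1
      simp only [hv, norm_smul]
      calc ‖g ξ‖ * ‖T.laplace 1 a ξ x‖ ≤ (B * Real.exp (-b * ξ ^ 2)) *
            (M * ‖T.laplace 0 a ξ x‖) :=
            mul_le_mul (hgB ξ) h1 (norm_nonneg _) (by positivity)
        _ = _ := by ring
  obtain ⟨hL1, hL2⟩ := integral_norm_sq_laplace_zero_le hK ha x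
  have hsqb : ∀ ξ, ‖v ξ‖ ^ 2 ≤ (B * M) ^ 2 * ‖T.laplace 0 a ξ x‖ ^ 2 := by
    intro ξ
    rw [← mul_pow]
    refine pow_le_pow_left₀ (norm_nonneg _) ((hvb ξ).trans ?_) 2
    exact mul_le_of_le_one_left (by positivity) (hexp1 ξ)
  have hsq : Integrable fun ξ => ‖v ξ‖ ^ 2 := by
    refine (hL1.const_mul ((B * M) ^ 2)).mono' (hvc.norm.pow 2).aestronglyMeasurable
      (Eventually.of_forall fun ξ => ?_)
    rw [Real.norm_of_nonneg (by positivity)]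
    exact hsqb ξ
  -- Fubini needs integrability as well as square integrability; the Gaussian supplies it, and the
  -- resulting `L¹` norm does not enter the final bound.
  have hvi : Integrable v := by
    have h1 : ∀ ξ, ‖v ξ‖ ≤ Real.exp (-b * ξ ^ 2) *
        (B * M * ∫ t, ‖(expKernel 0 a t : ℂ) • T.orbit x t‖) := by
      intro ξ
      refine (hvb ξ).trans ?_
      gcongr
      refine (norm_integral_le_integral_norm _).trans (le_of_eq ?_)
      congr with t
      rw [norm_smul, norm_exp_I_mul_mul, one_mul]
    exact ((integrable_exp_neg_mul_sq hb).mul_const _).mono' hvc.aestronglyMeasurable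
      (Eventually.of_forall h1)
  have hkey : ∀ ξ, g ξ • T.laplace 2 a ξ x = T.laplace 0 a ξ (v ξ) := by
    intro ξ
    simp only [hv, laplace_smul]
    by_cases hN : N ξ = 0
    · rw [hgz ξ hN, zero_smul, zero_smul]
    · rw [laplace_two_eq hK ha (hlow ξ hN)]
  rw [integral_congr_ae (Eventually.of_forall hkey)]
  refine (norm_integral_laplace_zero_le hK ha hvc hvi
    ((memLp_two_iff_integrable_sq_norm hvc.aestronglyMeasurable).2 hsq)).trans ?_
  have h5 : ∫ ξ, ‖v ξ‖ ^ 2 ≤ (B * M) ^ 2 * (2 * Real.pi * (K ^ 2 * (1 / (2 * a)))) := by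
    calc ∫ ξ, ‖v ξ‖ ^ 2 ≤ ∫ ξ, (B * M) ^ 2 * ‖T.laplace 0 a ξ x‖ ^ 2 :=
          integral_mono hsq (hL1.const_mul _) hsqb
      _ ≤ (B * M) ^ 2 * (2 * Real.pi * ((K * ‖x‖) ^ 2 * (1 / (2 * a)))) := by
          rw [integral_const_mul]
          gcongr
      _ ≤ _ := by
          gcongr
          exact mul_le_of_le_one_right hK0 hx
  calc _ ≤ K / 2 * (1 / (2 * a) + 2 * Real.pi *
        ((B * M) ^ 2 * (2 * Real.pi * (K ^ 2 * (1 / (2 * a)))))) := by gcongr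
    _ = _ := by
      field_simp

end C0Semigroup

/-! ### Gaussian summability and Fourier inversion -/

section Gaussian

variable {X : Type*} [NormedAddCommGroup X] [NormedSpace ℂ X]

/-- The Gaussian approximate identity on the line. -/
noncomputable def gaussianKernel (c u : ℝ) : ℝ :=
  √(Real.pi * c) * Real.exp (-(Real.pi ^ 2 * c) * u ^ 2)

theorem gaussianKernel_nonneg (c u : ℝ) : 0 ≤ gaussianKernel c u := by
  unfold gaussianKernel
  positivity

theorem continuous_gaussianKernel (c : ℝ) : Continuous (gaussianKernel c) := by
  unfold gaussianKernel
  fun_prop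

theorem integrable_gaussianKernel {c : ℝ} (hc : 0 < c) : Integrable (gaussianKernel c) :=
  (integrable_exp_neg_mul_sq (by positivity)).const_mul _

theorem integral_gaussianKernel {c : ℝ} (hc : 0 < c) : ∫ u, gaussianKernel c u = 1 := by
  have hpi := Real.pi_pos
  unfold gaussianKernel
  rw [integral_const_mul, integral_gaussian, ← Real.sqrt_mul (by positivity)]
  rw [show Real.pi * c * (Real.pi / (Real.pi ^ 2 * c)) = 1 by field_simp, Real.sqrt_one]

theorem tendsto_integral_gaussianKernel_smul [CompleteSpace X] {F : ℝ → X} (hF : Integrable F)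
    {u : ℝ} (hFc : ContinuousAt F u) :
    Tendsto (fun c => ∫ t, (gaussianKernel c (u - t) : ℂ) • F t) atTop (𝓝 (F u)) := by
  refine (Real.tendsto_integral_gaussian_smul' hF hFc).congr' ?_
  filter_upwards [eventually_gt_atTop 0] with c hc
  congr with t
  congr 1
  have habs : ((‖u - t‖ : ℝ) : ℂ) ^ 2 = ((u - t : ℝ) : ℂ) ^ 2 := by
    rw [← Complex.ofReal_pow, Real.norm_eq_abs, sq_abs, Complex.ofReal_pow]
  simp only [gaussianKernel, Module.finrank_self, Nat.cast_one, habs]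
  rw [Complex.ofReal_mul, Real.sqrt_eq_rpow, Complex.ofReal_cpow (by positivity)]
  push_cast
  congr 2
  ring

theorem integral_gaussian_mul_exp {c : ℝ} (hc : 0 < c) (u t : ℝ) :
    ∫ ξ : ℝ, Complex.exp (-((4 * Real.pi ^ 2 * c)⁻¹ : ℝ) * ξ ^ 2) *
      Complex.exp (-(Complex.I * ξ * u)) * Complex.exp (Complex.I * ξ * t) =
      2 * Real.pi * gaussianKernel c (u - t) := by
  have hpi := Real.pi_pos
  have hpi' : (Real.pi : ℂ) ≠ 0 := by exact_mod_cast hpi.ne'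
  have hc' : (c : ℂ) ≠ 0 := by exact_mod_cast hc.ne'
  have hb : 0 < ((((4 * Real.pi ^ 2 * c)⁻¹ : ℝ) : ℂ)).re := by
    rw [Complex.ofReal_re]
    positivity
  have h := fourierIntegral_gaussian hb ((t - u : ℝ) : ℂ)
  have e : ∀ ξ : ℝ, Complex.exp (-((4 * Real.pi ^ 2 * c)⁻¹ : ℝ) * ξ ^ 2) *
      Complex.exp (-(Complex.I * ξ * u)) * Complex.exp (Complex.I * ξ * t) =
      Complex.exp (Complex.I * ((t - u : ℝ) : ℂ) * ξ) *
        Complex.exp (-((4 * Real.pi ^ 2 * c)⁻¹ : ℝ) * ξ ^ 2) := by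
    intro ξ
    rw [← Complex.exp_add, ← Complex.exp_add, ← Complex.exp_add]
    congr 1
    push_cast
    ring
  simp only [e]
  rw [h]
  have e1 : ((Real.pi : ℂ) / (((4 * Real.pi ^ 2 * c)⁻¹ : ℝ) : ℂ)) ^ (1 / 2 : ℂ) =
      ((2 * Real.pi * √(Real.pi * c) : ℝ) : ℂ) := by
    rw [show (1 / 2 : ℂ) = ((1 / 2 : ℝ) : ℂ) by push_cast; rfl, ← Complex.ofReal_div,
      ← Complex.ofReal_cpow (by positivity), ← Real.sqrt_eq_rpow]
    congr 1
    rw [show Real.pi / (4 * Real.pi ^ 2 * c)⁻¹ = (2 * Real.pi) ^ 2 * (Real.pi * c) by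
      field_simp; ring, Real.sqrt_mul (by positivity), Real.sqrt_sq (by positivity)]
  rw [e1, gaussianKernel]
  push_cast
  rw [← mul_assoc]
  congr 2
  field_simp
  ring

theorem norm_cexp_neg_mul_sq (b ξ : ℝ) :
    ‖Complex.exp (-(b : ℂ) * (ξ : ℂ) ^ 2)‖ = Real.exp (-b * ξ ^ 2) := by
  rw [Complex.norm_exp]
  norm_cast

theorem norm_exp_neg_I_mul_mul (ξ t : ℝ) : ‖Complex.exp (-(Complex.I * ξ * t))‖ = 1 := by
  rw [Complex.exp_neg, norm_inv, C0Semigroup.norm_exp_I_mul_mul, inv_one]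

theorem integral_gaussian_smul_integral_exp_smul [CompleteSpace X] {F : ℝ → X} (hF : Integrable F) {c : ℝ}
    (hc : 0 < c) (u : ℝ) :
    ∫ ξ : ℝ, (Complex.exp (-((4 * Real.pi ^ 2 * c)⁻¹ : ℝ) * ξ ^ 2) *
      Complex.exp (-(Complex.I * ξ * u))) • ∫ t : ℝ, Complex.exp (Complex.I * ξ * t) • F t =
      (2 * Real.pi : ℂ) • ∫ t, (gaussianKernel c (u - t) : ℂ) • F t := by
  set b : ℝ := (4 * Real.pi ^ 2 * c)⁻¹ with hbdef
  have hb : 0 < b := by positivity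
  have hint : Integrable (Function.uncurry fun ξ t : ℝ =>
      (Complex.exp (-(b : ℂ) * ξ ^ 2) * Complex.exp (-(Complex.I * ξ * u)) *
        Complex.exp (Complex.I * ξ * t)) • F t) (volume.prod volume) := by
    refine Integrable.mono' ((integrable_exp_neg_mul_sq hb).mul_prod hF.norm) ?_ ?_
    · exact (Continuous.aestronglyMeasurable (by fun_prop)).smul hF.1.comp_snd
    · refine Eventually.of_forall fun p => ?_
      simp only [Function.uncurry]
      rw [norm_smul, norm_mul, norm_mul, C0Semigroup.norm_exp_I_mul_mul, mul_one,
        norm_exp_neg_I_mul_mul, mul_one, norm_cexp_neg_mul_sq]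
  simp only [← integral_smul, smul_smul]
  rw [integral_integral_swap hint]
  congr with t
  rw [integral_smul_const, hbdef, integral_gaussian_mul_exp hc]

theorem norm_integral_gaussianKernel_smul_le {F : ℝ → X} {S : ℝ} (hS : ∀ t, ‖F t‖ ≤ S) {c : ℝ}
    (hc : 0 < c) (u : ℝ) : ‖∫ t, (gaussianKernel c (u - t) : ℂ) • F t‖ ≤ S := by
  have h1 : Integrable fun t => gaussianKernel c (u - t) :=
    (integrable_gaussianKernel hc).comp_sub_left u
  refine (norm_integral_le_of_norm_le (h1.mul_const S) (Eventually.of_forall fun t => ?_)).trans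
    (le_of_eq ?_)
  · rw [norm_smul, Complex.norm_real, Real.norm_of_nonneg (gaussianKernel_nonneg _ _)]
    exact mul_le_mul_of_nonneg_left (hS t) (gaussianKernel_nonneg _ _)
  · rw [integral_mul_const, integral_sub_left_eq_self (gaussianKernel c) volume u,
      integral_gaussianKernel hc, one_mul]

variable {Ω : Type*} [MeasurableSpace Ω]

/-- The Fourier transform of the image under `r` of the complex measure with density `h`. -/
noncomputable def fourierDensity (m : Measure Ω) (r : Ω → ℝ) (h : Ω → ℂ) (ξ : ℝ) : ℂ :=
  ∫ ω, h ω * Complex.exp (-(Complex.I * ξ * r ω)) ∂m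

theorem norm_fourierDensity_le (m : Measure Ω) (r : Ω → ℝ) (h : Ω → ℂ) (ξ : ℝ) :
    ‖fourierDensity m r h ξ‖ ≤ ∫ ω, ‖h ω‖ ∂m := by
  refine (norm_integral_le_integral_norm _).trans (le_of_eq ?_)
  congr with ω
  rw [norm_mul, norm_exp_neg_I_mul_mul, mul_one]

theorem continuous_fourierDensity {m : Measure Ω} {r : Ω → ℝ} (hr : Measurable r) {h : Ω → ℂ}
    (hh : Integrable h m) : Continuous (fourierDensity m r h) := by
  refine continuous_of_dominated (fun ξ => ?_) (fun ξ => Eventually.of_forall fun ω => ?_)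
    hh.norm (Eventually.of_forall fun ω => ?_)
  · exact hh.1.mul (Measurable.aestronglyMeasurable (by fun_prop))
  · rw [norm_mul, norm_exp_neg_I_mul_mul, mul_one]
  · fun_prop

/-- Fourier inversion for `τ ↦ ∫ F(τ + r) dν(r)`. By Fubini the regularised integral equals `2π`
times the `ν`-average of a Gaussian mollification of `F`, which converges pointwise and stays
bounded by `S`. -/
theorem tendsto_integral_gaussian_fourierDensity [CompleteSpace X] {m : Measure Ω} [SFinite m]
    {r : Ω → ℝ} (hr : Measurable r) {h : Ω → ℂ} (hh : Integrable h m) {F : ℝ → X}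
    (hF : Integrable F) (hFc : Continuous F) {S : ℝ} (hS : ∀ t, ‖F t‖ ≤ S) (τ : ℝ) :
    Tendsto (fun c : ℝ => ∫ ξ : ℝ, (Complex.exp (-((4 * Real.pi ^ 2 * c)⁻¹ : ℝ) * ξ ^ 2) *
      fourierDensity m r h ξ * Complex.exp (-(Complex.I * ξ * τ))) •
        ∫ t : ℝ, Complex.exp (Complex.I * ξ * t) • F t) atTop
      (𝓝 ((2 * Real.pi : ℂ) • ∫ ω, h ω • F (τ + r ω) ∂m)) := by
  have hFh : Continuous fun ξ : ℝ => ∫ t : ℝ, Complex.exp (Complex.I * ξ * t) • F t := by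
    refine continuous_of_dominated (fun ξ => ?_) (fun ξ => Eventually.of_forall fun t => ?_)
      hF.norm (Eventually.of_forall fun t => ?_)
    · exact (Continuous.aestronglyMeasurable (by fun_prop)).smul hF.1
    · rw [norm_smul, C0Semigroup.norm_exp_I_mul_mul, one_mul]
    · fun_prop
  have hFb : ∀ ξ : ℝ, ‖∫ t : ℝ, Complex.exp (Complex.I * ξ * t) • F t‖ ≤ ∫ t, ‖F t‖ := by
    intro ξ
    refine (norm_integral_le_integral_norm _).trans (le_of_eq ?_)
    congr with t
    rw [norm_smul, C0Semigroup.norm_exp_I_mul_mul, one_mul]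
  have key : ∀ c : ℝ, 0 < c →
      ∫ ξ : ℝ, (Complex.exp (-((4 * Real.pi ^ 2 * c)⁻¹ : ℝ) * ξ ^ 2) *
        fourierDensity m r h ξ * Complex.exp (-(Complex.I * ξ * τ))) •
          (∫ t : ℝ, Complex.exp (Complex.I * ξ * t) • F t) =
      ∫ ω, h ω • ((2 * Real.pi : ℂ) • ∫ t, (gaussianKernel c (τ + r ω - t) : ℂ) • F t) ∂m := by
    intro c hc
    simp only [← integral_gaussian_smul_integral_exp_smul hF hc]
    set b : ℝ := (4 * Real.pi ^ 2 * c)⁻¹ with hbdef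
    have hb : 0 < b := by positivity
    set Fh : ℝ → X := fun ξ => ∫ t : ℝ, Complex.exp (Complex.I * ξ * t) • F t
    have hint : Integrable (Function.uncurry fun (ξ : ℝ) (ω : Ω) => h ω •
        ((Complex.exp (-(b : ℂ) * ξ ^ 2) * Complex.exp (-(Complex.I * ξ * (τ + r ω : ℝ)))) •
          Fh ξ)) (volume.prod m) := by
      refine Integrable.mono' (((integrable_exp_neg_mul_sq hb).mul_prod hh.norm).mul_const
        (∫ t, ‖F t‖)) ?_ ?_
      · refine hh.1.comp_snd.smul (AEStronglyMeasurable.smul ?_ ?_)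
        · exact Measurable.aestronglyMeasurable (by fun_prop)
        · exact hFh.aestronglyMeasurable.comp_fst
      · refine Eventually.of_forall fun p => ?_
        simp only [Function.uncurry]
        rw [norm_smul, norm_smul, norm_mul, norm_exp_neg_I_mul_mul, mul_one,
          norm_cexp_neg_mul_sq, ← mul_assoc, mul_comm ‖h p.2‖]
        gcongr
        exact hFb p.1
    have e0 : ∀ ω, h ω • (∫ ξ : ℝ, (Complex.exp (-(b : ℂ) * ξ ^ 2) *
        Complex.exp (-(Complex.I * ξ * (τ + r ω : ℝ)))) • Fh ξ) =
        ∫ ξ : ℝ, h ω • ((Complex.exp (-(b : ℂ) * ξ ^ 2) *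
          Complex.exp (-(Complex.I * ξ * (τ + r ω : ℝ)))) • Fh ξ) :=
      fun ω => (integral_smul _ _).symm
    refine Eq.trans ?_ (integral_congr_ae (Eventually.of_forall e0)).symm
    rw [← integral_integral_swap hint]
    congr with ξ
    have e : ∀ ω, h ω • ((Complex.exp (-(b : ℂ) * ξ ^ 2) *
        Complex.exp (-(Complex.I * ξ * (τ + r ω : ℝ)))) • Fh ξ) =
        (h ω * Complex.exp (-(Complex.I * ξ * r ω))) • ((Complex.exp (-(b : ℂ) * ξ ^ 2) *
          Complex.exp (-(Complex.I * ξ * τ))) • Fh ξ) := by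
      intro ω
      rw [smul_smul, smul_smul]
      congr 1
      rw [show -(Complex.I * ξ * (τ + r ω : ℝ)) = -(Complex.I * ξ * τ) + -(Complex.I * ξ * r ω) by
        push_cast; ring, Complex.exp_add]
      ring
    simp only [e]
    rw [integral_smul_const, fourierDensity, smul_smul]
    congr 1
    ring
  have hlim : Tendsto (fun c : ℝ => ∫ ω, h ω • ((2 * Real.pi : ℂ) •
      ∫ t, (gaussianKernel c (τ + r ω - t) : ℂ) • F t) ∂m) atTop
      (𝓝 (∫ ω, h ω • ((2 * Real.pi : ℂ) • F (τ + r ω)) ∂m)) := by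
    refine tendsto_integral_filter_of_dominated_convergence
      (fun ω => ‖h ω‖ * (‖(2 * Real.pi : ℂ)‖ * S)) ?_ ?_ (hh.norm.mul_const _) ?_
    · filter_upwards [eventually_gt_atTop 0] with c hc
      have hcont : Continuous fun u => ∫ t, (gaussianKernel c (u - t) : ℂ) • F t := by
        have := continuous_gaussianKernel c
        have e : ∀ u, ∫ t, (gaussianKernel c (u - t) : ℂ) • F t =
            ∫ t, (gaussianKernel c t : ℂ) • F (u - t) := by
          intro u
          rw [← integral_sub_left_eq_self _ volume u]
          simp
        simp only [e]
        refine continuous_of_dominated (bound := fun t => gaussianKernel c t * S)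
          (fun u => ?_) (fun u => Eventually.of_forall fun t => ?_)
          ((integrable_gaussianKernel hc).mul_const S) (Eventually.of_forall fun t => ?_)
        · exact Continuous.aestronglyMeasurable (by fun_prop)
        · rw [norm_smul, Complex.norm_real, Real.norm_of_nonneg (gaussianKernel_nonneg _ _)]
          exact mul_le_mul_of_nonneg_left (hS _) (gaussianKernel_nonneg _ _)
        · fun_prop
      refine hh.1.smul ((hcont.comp_aestronglyMeasurable
        (f := fun ω => τ + r ω) ?_).const_smul _)
      exact (hr.const_add τ).aestronglyMeasurable
    · filter_upwards [eventually_gt_atTop 0] with c hc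
      refine Eventually.of_forall fun ω => ?_
      rw [norm_smul, norm_smul]
      gcongr
      exact norm_integral_gaussianKernel_smul_le hS hc _
    · refine Eventually.of_forall fun ω => ?_
      exact ((tendsto_integral_gaussianKernel_smul hF hFc.continuousAt).const_smul _).const_smul _
  have e : (2 * Real.pi : ℂ) • ∫ ω, h ω • F (τ + r ω) ∂m =
      ∫ ω, h ω • ((2 * Real.pi : ℂ) • F (τ + r ω)) ∂m := by
    rw [← integral_smul]
    congr with ω
    rw [smul_comm]
  rw [e]
  refine hlim.congr' ?_
  filter_upwards [eventually_gt_atTop 0] with c hc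
  exact (key c hc).symm

end Gaussian

/-! ### Rescaling the weight and removing it -/

theorem two_mul_expKernel_two_eq {τ : ℝ} (hτ : 0 < τ) (t : ℝ) :
    2 / τ ^ 2 * expKernel 2 (1 / τ) t = expKernel 0 0 t * (2 * expKernel 2 1 (t / τ)) := by
  by_cases ht : 0 ≤ t
  · have h1 : t ∈ Set.Ici (0 : ℝ) := ht
    have h2 : t / τ ∈ Set.Ici (0 : ℝ) := div_nonneg ht hτ.le
    simp only [expKernel, Set.indicator_of_mem h1, Set.indicator_of_mem h2]
    rw [show -(1 / τ) * t = -1 * (t / τ) by ring]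
    simp
    field_simp
  · have h1 : t ∉ Set.Ici (0 : ℝ) := ht
    simp only [expKernel, Set.indicator_of_notMem h1]
    simp

theorem two_mul_expKernel_two_one : 2 * expKernel 2 1 1 = Real.exp (-1) := by
  have h1 : (1 : ℝ) ∈ Set.Ici (0 : ℝ) := Set.mem_Ici.2 zero_le_one
  simp only [expKernel, Set.indicator_of_mem h1]
  simp

theorem expKernel_le_pow (k : ℕ) {a : ℝ} (ha : 0 < a) (t : ℝ) :
    expKernel k a t ≤ (2 / a) ^ k := by
  refine (expKernel_le k ha t).trans (Set.indicator_apply_le' (fun ht => ?_) fun _ => ?_)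
  · have ht' : (0 : ℝ) ≤ t := ht
    refine mul_le_of_le_one_right (by positivity) (Real.exp_le_one_iff.2 ?_)
    nlinarith
  · positivity

theorem expKernel_zero_zero_le (t : ℝ) : expKernel 0 0 t ≤ 1 := by
  refine Set.indicator_apply_le' (fun ht => ?_) fun _ => zero_le_one
  simp

namespace C0Semigroup

section

variable {X : Type*} [NormedAddCommGroup X] [NormedSpace ℂ X]
variable {Ω : Type*} [MeasurableSpace Ω]

/-- The integral of `T(τ + r(ω))x` over those `ω` with `τ + r(ω) ≥ 0`, with respect to the
complex measure with density `h`. -/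
noncomputable def shiftIntegral (T : C0Semigroup X) (m : Measure Ω) (r : Ω → ℝ) (h : Ω → ℂ)
    (τ : ℝ) (x : X) : X :=
  ∫ ω, h ω • ((expKernel 0 0 (τ + r ω) : ℂ) • T.orbit x (τ + r ω)) ∂m

theorem norm_shiftIntegral_le {T : C0Semigroup X} {K : ℝ} (hK : ∀ t, ‖T.op t‖ ≤ K)
    {m : Measure Ω} {r : Ω → ℝ} {h : Ω → ℂ} (hh : Integrable h m) (τ : ℝ) (x : X) :
    ‖T.shiftIntegral m r h τ x‖ ≤ (∫ ω, ‖h ω‖ ∂m) * (K * ‖x‖) := by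
  have hK0 : 0 ≤ K := (norm_nonneg _).trans (hK 0)
  rw [← integral_mul_const]
  refine norm_integral_le_of_norm_le (hh.norm.mul_const _) (Eventually.of_forall fun ω => ?_)
  rw [norm_smul]
  gcongr
  refine (norm_expKernel_smul_orbit_le hK 0 0 x _).trans ?_
  exact mul_le_of_le_one_left (by positivity) (expKernel_zero_zero_le _)

theorem integrable_density_smul {T : C0Semigroup X} {K : ℝ} (hK : ∀ t, ‖T.op t‖ ≤ K)
    {m : Measure Ω} {r : Ω → ℝ} (hr : Measurable r) {h : Ω → ℂ} (hh : Integrable h m)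
    {k : ℕ} {a B : ℝ} (hB : ∀ t, expKernel k a t ≤ B) (τ : ℝ) (x : X) :
    Integrable (fun ω => h ω • ((expKernel k a (τ + r ω) : ℂ) • T.orbit x (τ + r ω))) m := by
  have hK0 : 0 ≤ K := (norm_nonneg _).trans (hK 0)
  refine (hh.norm.mul_const (B * (K * ‖x‖))).mono' (hh.1.smul (AEStronglyMeasurable.smul ?_ ?_))
    (Eventually.of_forall fun ω => ?_)
  · exact (Complex.measurable_ofReal.comp ((measurable_expKernel k a).comp
      (hr.const_add τ))).aestronglyMeasurable
  · exact (T.continuous_orbit_real x).comp_aestronglyMeasurable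
      (hr.const_add τ).aestronglyMeasurable
  · rw [norm_smul]
    gcongr
    refine (norm_expKernel_smul_orbit_le hK k a x _).trans ?_
    gcongr
    exact hB _

/-- The error made by replacing the smooth cut-off `u² e^{-u}`, `u = (τ + r)/τ`, by its value at
`u = 1`. -/
noncomputable def cutoffError (m : Measure Ω) (r : Ω → ℝ) (h : Ω → ℂ) (τ : ℝ) : ℝ :=
  ∫ ω, ‖h ω‖ * |2 * expKernel 2 1 ((τ + r ω) / τ) - Real.exp (-1)| ∂m

/-- The constant is `2 · (2/1)²`, from `expKernel_le_pow`. -/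
theorem abs_cutoff_le (u : ℝ) : |2 * expKernel 2 1 u - Real.exp (-1)| ≤ 8 := by
  have h1 := expKernel_le_pow 2 one_pos u
  have h2 := expKernel_nonneg 2 1 u
  have h3 : Real.exp (-1) ≤ 1 := Real.exp_le_one_iff.2 (by norm_num)
  have h4 := Real.exp_pos (-1)
  rw [abs_le]
  constructor <;> nlinarith

theorem integrable_cutoff {m : Measure Ω} {r : Ω → ℝ} (hr : Measurable r) {h : Ω → ℂ}
    (hh : Integrable h m) (τ : ℝ) : Integrable
      (fun ω => ‖h ω‖ * |2 * expKernel 2 1 ((τ + r ω) / τ) - Real.exp (-1)|) m := by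
  refine (hh.norm.mul_const 8).mono' (hh.1.norm.mul ?_) (Eventually.of_forall fun ω => ?_)
  · have h1 : Measurable fun ω => |2 * expKernel 2 1 ((τ + r ω) / τ) - Real.exp (-1)| := by
      have := measurable_expKernel 2 1
      fun_prop
    exact h1.aestronglyMeasurable
  · rw [Real.norm_of_nonneg (by positivity)]
    gcongr
    exact abs_cutoff_le _

theorem tendsto_cutoffError {m : Measure Ω} {r : Ω → ℝ} (hr : Measurable r) {h : Ω → ℂ}
    (hh : Integrable h m) : Tendsto (cutoffError m r h) atTop (𝓝 0) := by
  have : Tendsto (cutoffError m r h) atTop (𝓝 (∫ _ : Ω, (0 : ℝ) ∂m)) := by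
    refine tendsto_integral_filter_of_dominated_convergence (fun ω => ‖h ω‖ * 8)
      (Eventually.of_forall fun τ => (integrable_cutoff hr hh τ).1)
      (Eventually.of_forall fun τ => Eventually.of_forall fun ω => ?_) (hh.norm.mul_const 8)
      (Eventually.of_forall fun ω => ?_)
    · rw [Real.norm_of_nonneg (by positivity)]
      gcongr
      exact abs_cutoff_le _
    · have h1 : Tendsto (fun τ : ℝ => (τ + r ω) / τ) atTop (𝓝 1) := by
        have h2 : Tendsto (fun τ : ℝ => 1 + r ω / τ) atTop (𝓝 (1 + 0)) :=
          tendsto_const_nhds.add (tendsto_const_nhds.div_atTop tendsto_id)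
        rw [add_zero] at h2
        refine h2.congr' ?_
        filter_upwards [eventually_gt_atTop 0] with τ hτ
        field_simp
      have h3 : Tendsto (fun τ : ℝ => ‖h ω‖ *
          |2 * expKernel 2 1 ((τ + r ω) / τ) - Real.exp (-1)|) atTop
          (𝓝 (‖h ω‖ * |2 * expKernel 2 1 1 - Real.exp (-1)|)) := by
        have h4 := ((continuous_expKernel_succ 1 1).tendsto 1).comp h1
        exact ((h4.const_mul 2).sub_const _).abs.const_mul _
      simpa [two_mul_expKernel_two_one] using h3
  simpa using this

theorem norm_shiftIntegral_sub_le {T : C0Semigroup X} {K : ℝ} (hK : ∀ t, ‖T.op t‖ ≤ K)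
    {m : Measure Ω} {r : Ω → ℝ} (hr : Measurable r) {h : Ω → ℂ} (hh : Integrable h m)
    {τ : ℝ} (hτ : 0 < τ) (x : X) :
    ‖((2 / τ ^ 2 : ℝ) : ℂ) • (∫ ω, h ω • ((expKernel 2 (1 / τ) (τ + r ω) : ℂ) •
      T.orbit x (τ + r ω)) ∂m) - (Real.exp (-1) : ℂ) • T.shiftIntegral m r h τ x‖ ≤
      cutoffError m r h τ * (K * ‖x‖) := by
  have hK0 : 0 ≤ K := (norm_nonneg _).trans (hK 0)
  have i1 : Integrable (fun ω => h ω • ((expKernel 2 (1 / τ) (τ + r ω) : ℂ) •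
      T.orbit x (τ + r ω))) m :=
    integrable_density_smul hK hr hh (expKernel_le_pow 2 (by positivity)) τ x
  have i0 : Integrable (fun ω => h ω • ((expKernel 0 0 (τ + r ω) : ℂ) •
      T.orbit x (τ + r ω))) m :=
    integrable_density_smul hK hr hh expKernel_zero_zero_le τ x
  have j1 : Integrable (fun ω => ((2 / τ ^ 2 : ℝ) : ℂ) • (h ω •
      ((expKernel 2 (1 / τ) (τ + r ω) : ℂ) • T.orbit x (τ + r ω)))) m := i1.smul _
  have j0 : Integrable (fun ω => (Real.exp (-1) : ℂ) • (h ω •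
      ((expKernel 0 0 (τ + r ω) : ℂ) • T.orbit x (τ + r ω)))) m := i0.smul _
  rw [shiftIntegral, ← integral_smul, ← integral_smul, ← integral_sub j1 j0,
    cutoffError, ← integral_mul_const]
  refine norm_integral_le_of_norm_le ((integrable_cutoff hr hh τ).mul_const _)
    (Eventually.of_forall fun ω => ?_)
  have e : ((2 / τ ^ 2 : ℝ) : ℂ) • (h ω • ((expKernel 2 (1 / τ) (τ + r ω) : ℂ) •
      T.orbit x (τ + r ω))) - (Real.exp (-1) : ℂ) • (h ω • ((expKernel 0 0 (τ + r ω) : ℂ) •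
      T.orbit x (τ + r ω))) =
      (h ω * ((2 * expKernel 2 1 ((τ + r ω) / τ) - Real.exp (-1) : ℝ) : ℂ)) •
        ((expKernel 0 0 (τ + r ω) : ℂ) • T.orbit x (τ + r ω)) := by
    simp only [smul_smul, ← sub_smul]
    congr 1
    have := congrArg (fun u : ℝ => (u : ℂ)) (two_mul_expKernel_two_eq hτ (τ + r ω))
    simp only [Complex.ofReal_mul] at this
    rw [mul_left_comm, this, Complex.ofReal_sub, Complex.ofReal_mul]
    ring
  rw [e, norm_smul, norm_mul, Complex.norm_real, Real.norm_eq_abs]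
  gcongr
  refine (norm_expKernel_smul_orbit_le hK 0 0 x _).trans ?_
  exact mul_le_of_le_one_left (by positivity) (expKernel_zero_zero_le _)

end

variable {X : Type*} [NormedAddCommGroup X] [InnerProductSpace ℂ X] [CompleteSpace X]
variable {Ω₁ Ω₂ : Type*} [MeasurableSpace Ω₁] [MeasurableSpace Ω₂]

/-- Inversion turns the left side into the integrals of the core estimate with `N` the sum of two
transforms. Keeping two measure spaces lets `μ` on `[0,∞)` and a density on `ℝ` be treated together
without forming their sum. -/
theorem norm_integral_expKernel_two_add_le {T : C0Semigroup X} {K : ℝ}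
    (hK : ∀ t, ‖T.op t‖ ≤ K) {U : Set ℝ} {M a : ℝ} (hM : 0 ≤ M) (ha : 0 < a)
    (hlow : ∀ ξ ∉ U, ∀ x y, (x, y) ∈ T.generatorGraph →
      ‖x‖ ≤ M * ‖((a : ℂ) - Complex.I * ξ) • x - y‖)
    {m₁ : Measure Ω₁} [SFinite m₁] {r₁ : Ω₁ → ℝ} (hr₁ : Measurable r₁) {h₁ : Ω₁ → ℂ}
    (hh₁ : Integrable h₁ m₁) {m₂ : Measure Ω₂} [SFinite m₂] {r₂ : Ω₂ → ℝ} (hr₂ : Measurable r₂)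
    {h₂ : Ω₂ → ℂ} (hh₂ : Integrable h₂ m₂)
    (hU : ∀ ξ ∈ U, fourierDensity m₁ r₁ h₁ ξ + fourierDensity m₂ r₂ h₂ ξ = 0)
    (τ : ℝ) {x : X} (hx : ‖x‖ ≤ 1) :
    ‖(∫ ω, h₁ ω • ((expKernel 2 a (τ + r₁ ω) : ℂ) • T.orbit x (τ + r₁ ω)) ∂m₁) +
      ∫ ω, h₂ ω • ((expKernel 2 a (τ + r₂ ω) : ℂ) • T.orbit x (τ + r₂ ω)) ∂m₂‖ ≤
      K / 2 * (1 / 2 + 2 * Real.pi * ((((∫ ω, ‖h₁ ω‖ ∂m₁) + ∫ ω, ‖h₂ ω‖ ∂m₂) * M) ^ 2 *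
        (2 * Real.pi * (K ^ 2 / 2)))) / a := by
  have hK0 : 0 ≤ K := (norm_nonneg _).trans (hK 0)
  have hpi := Real.pi_gt_three
  set N₁ := fourierDensity m₁ r₁ h₁
  set N₂ := fourierDensity m₂ r₂ h₂
  have hN₁c : Continuous N₁ := continuous_fourierDensity hr₁ hh₁
  have hN₂c : Continuous N₂ := continuous_fourierDensity hr₂ hh₂
  set F : ℝ → X := fun t => (expKernel 2 a t : ℂ) • T.orbit x t with hFdef
  have hFi : Integrable F := integrable_expKernel_smul_orbit hK 2 ha x
  have hFc : Continuous F := by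
    have h1 := continuous_expKernel_succ 1 a
    have h2 := T.continuous_orbit_real x
    exact (Complex.continuous_ofReal.comp h1).smul h2
  have hFb : ∀ t, ‖F t‖ ≤ (2 / a) ^ 2 * (K * ‖x‖) := fun t =>
    (norm_expKernel_smul_orbit_le hK 2 a x t).trans
      (mul_le_mul_of_nonneg_right (expKernel_le_pow 2 ha t) (by positivity))
  have hLc := continuous_laplace hK 2 ha x
  have hLb : ∀ ξ, ‖T.laplace 2 a ξ x‖ ≤ ∫ t, ‖F t‖ := by
    intro ξ
    refine (norm_integral_le_integral_norm _).trans (le_of_eq ?_)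
    congr with t
    rw [norm_smul, norm_exp_I_mul_mul, one_mul]
  have hint : ∀ {N : ℝ → ℂ} {B b : ℝ}, Continuous N → (∀ ξ, ‖N ξ‖ ≤ B) → 0 < b →
      Integrable fun ξ : ℝ => (Complex.exp (-(b : ℂ) * ξ ^ 2) * N ξ *
        Complex.exp (-(Complex.I * ξ * τ))) • T.laplace 2 a ξ x := by
    intro N B b hN hB hb
    refine ((integrable_exp_neg_mul_sq hb).mul_const (B * ∫ t, ‖F t‖)).mono'
      (Continuous.aestronglyMeasurable (by fun_prop)) (Eventually.of_forall fun ξ => ?_)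
    rw [norm_smul, norm_mul, norm_mul, norm_exp_neg_I_mul_mul, mul_one, norm_cexp_neg_mul_sq,
      mul_assoc]
    have := (norm_nonneg _).trans (hB ξ)
    gcongr
    · exact hB ξ
    · exact hLb ξ
  have t1 := tendsto_integral_gaussian_fourierDensity hr₁ hh₁ hFi hFc hFb τ
  have t2 := tendsto_integral_gaussian_fourierDensity hr₂ hh₂ hFi hFc hFb τ
  have t3 := t1.add t2
  rw [← smul_add] at t3
  have hle : ‖(2 * Real.pi : ℂ) • ((∫ ω, h₁ ω • F (τ + r₁ ω) ∂m₁) +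
      ∫ ω, h₂ ω • F (τ + r₂ ω) ∂m₂)‖ ≤
      K / 2 * (1 / 2 + 2 * Real.pi * ((((∫ ω, ‖h₁ ω‖ ∂m₁) + ∫ ω, ‖h₂ ω‖ ∂m₂) * M) ^ 2 *
        (2 * Real.pi * (K ^ 2 / 2)))) / a := by
    refine le_of_tendsto t3.norm ?_
    filter_upwards [eventually_gt_atTop 0] with c hc
    have hb : 0 < (4 * Real.pi ^ 2 * c)⁻¹ := by positivity
    have hNb : ∀ ξ, ‖(N₁ + N₂) ξ‖ ≤ (∫ ω, ‖h₁ ω‖ ∂m₁) + ∫ ω, ‖h₂ ω‖ ∂m₂ := fun ξ =>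
      (norm_add_le _ _).trans (add_le_add (norm_fourierDensity_le m₁ r₁ h₁ ξ)
        (norm_fourierDensity_le m₂ r₂ h₂ ξ))
    have hmain := norm_integral_gaussian_laplace_le hK (hN₁c.add hN₂c) hNb ha hM
      (fun ξ hξ x y hxy => hlow ξ (fun hξU => hξ (hU ξ hξU)) x y hxy) hb τ hx
    refine le_trans (le_of_eq ?_) hmain
    congr 1
    have e := integral_add (hint hN₁c (norm_fourierDensity_le m₁ r₁ h₁) hb)
      (hint hN₂c (norm_fourierDensity_le m₂ r₂ h₂) hb)
    refine e.symm.trans (integral_congr_ae (Eventually.of_forall fun ξ => ?_))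
    simp only [Pi.add_apply]
    rw [← add_smul]
    congr 1
    ring
  refine le_trans ?_ hle
  rw [norm_smul]
  -- The factor `2π ≥ 1` is simply discarded.
  refine le_mul_of_one_le_left (norm_nonneg _) ?_
  rw [show (2 * Real.pi : ℂ) = ((2 * Real.pi : ℝ) : ℂ) by push_cast; rfl, Complex.norm_real,
    Real.norm_of_nonneg (by positivity)]
  linarith

/-- If the Fourier transform of a complex measure vanishes on an open set outside of which the
resolvent is bounded near the imaginary axis, then the associated shifted integrals of the
semigroup tend to zero in operator norm. -/
theorem eventually_norm_shiftIntegral_add_le {T : C0Semigroup X} {K : ℝ}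
    (hK : ∀ t, ‖T.op t‖ ≤ K) {U : Set ℝ} {M a₀ : ℝ} (hM : 0 ≤ M) (ha₀ : 0 < a₀)
    (hlow : ∀ a : ℝ, 0 < a → a ≤ a₀ → ∀ ξ ∉ U, ∀ x y, (x, y) ∈ T.generatorGraph →
      ‖x‖ ≤ M * ‖((a : ℂ) - Complex.I * ξ) • x - y‖)
    {m₁ : Measure Ω₁} [SFinite m₁] {r₁ : Ω₁ → ℝ} (hr₁ : Measurable r₁) {h₁ : Ω₁ → ℂ}
    (hh₁ : Integrable h₁ m₁) {m₂ : Measure Ω₂} [SFinite m₂] {r₂ : Ω₂ → ℝ} (hr₂ : Measurable r₂)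
    {h₂ : Ω₂ → ℂ} (hh₂ : Integrable h₂ m₂)
    (hU : ∀ ξ ∈ U, fourierDensity m₁ r₁ h₁ ξ + fourierDensity m₂ r₂ h₂ ξ = 0)
    {ε : ℝ} (hε : 0 < ε) :
    ∀ᶠ τ in atTop, ∀ x : X, ‖x‖ ≤ 1 →
      ‖T.shiftIntegral m₁ r₁ h₁ τ x + T.shiftIntegral m₂ r₂ h₂ τ x‖ ≤ ε := by
  have hK0 : 0 ≤ K := (norm_nonneg _).trans (hK 0)
  set D : ℝ := K / 2 * (1 / 2 + 2 * Real.pi * ((((∫ ω, ‖h₁ ω‖ ∂m₁) + ∫ ω, ‖h₂ ω‖ ∂m₂) * M) ^ 2 *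
    (2 * Real.pi * (K ^ 2 / 2)))) with hD
  have hlim : Tendsto (fun τ : ℝ => Real.exp 1 * (2 * D / τ +
      (cutoffError m₁ r₁ h₁ τ * K + cutoffError m₂ r₂ h₂ τ * K))) atTop (𝓝 0) := by
    have h1 : Tendsto (fun τ : ℝ => 2 * D / τ) atTop (𝓝 0) :=
      tendsto_const_nhds.div_atTop tendsto_id
    have h2 := ((tendsto_cutoffError hr₁ hh₁).mul_const K).add
      ((tendsto_cutoffError hr₂ hh₂).mul_const K)
    simpa using (h1.add h2).const_mul (Real.exp 1)
  filter_upwards [hlim.eventually (Iio_mem_nhds hε), eventually_gt_atTop 0,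
    eventually_ge_atTop (1 / a₀)] with τ h1 hτ hτa x hx
  refine le_trans ?_ (le_of_lt h1)
  have ha : 1 / τ ≤ a₀ := by
    rw [div_le_iff₀ hτ]
    rw [div_le_iff₀ ha₀] at hτa
    linarith
  -- With `a = 1/τ` the bound is `Dτ`; multiplying by `2/τ²` leaves `2D/τ`.
  have hI := norm_integral_expKernel_two_add_le hK hM (one_div_pos.2 hτ)
    (hlow (1 / τ) (one_div_pos.2 hτ) ha) hr₁ hh₁ hr₂ hh₂ hU τ hx
  rw [← hD] at hI
  have hc : ∀ u : ℝ, 0 ≤ u → u * (K * ‖x‖) ≤ u * K := fun u hu =>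
    mul_le_mul_of_nonneg_left (mul_le_of_le_one_right hK0 hx) hu
  have e1 := (norm_shiftIntegral_sub_le hK hr₁ hh₁ hτ x).trans
    (hc _ (integral_nonneg fun _ => by positivity))
  have e2 := (norm_shiftIntegral_sub_le hK hr₂ hh₂ hτ x).trans
    (hc _ (integral_nonneg fun _ => by positivity))
  set I₁ := ∫ ω, h₁ ω • ((expKernel 2 (1 / τ) (τ + r₁ ω) : ℂ) • T.orbit x (τ + r₁ ω)) ∂m₁
  set I₂ := ∫ ω, h₂ ω • ((expKernel 2 (1 / τ) (τ + r₂ ω) : ℂ) • T.orbit x (τ + r₂ ω)) ∂m₂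
  set S₁ := T.shiftIntegral m₁ r₁ h₁ τ x
  set S₂ := T.shiftIntegral m₂ r₂ h₂ τ x
  set q : ℂ := ((2 / τ ^ 2 : ℝ) : ℂ) with hq
  have hqn : ‖q • (I₁ + I₂)‖ ≤ 2 * D / τ := by
    rw [norm_smul, hq, Complex.norm_real, Real.norm_of_nonneg (by positivity)]
    calc 2 / τ ^ 2 * ‖I₁ + I₂‖ ≤ 2 / τ ^ 2 * (D / (1 / τ)) := by gcongr
      _ = _ := by field_simp
  have hS : (S₁ + S₂) = (Real.exp 1 : ℂ) • (q • (I₁ + I₂) -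
      ((q • I₁ - (Real.exp (-1) : ℂ) • S₁) + (q • I₂ - (Real.exp (-1) : ℂ) • S₂))) := by
    have e3 : (Real.exp 1 : ℂ) * (Real.exp (-1) : ℂ) = 1 := by
      rw [← Complex.ofReal_mul, ← Real.exp_add]
      simp
    have e4 : q • (I₁ + I₂) -
      ((q • I₁ - (Real.exp (-1) : ℂ) • S₁) + (q • I₂ - (Real.exp (-1) : ℂ) • S₂)) =
      (Real.exp (-1) : ℂ) • (S₁ + S₂) := by
      rw [smul_add, smul_add]
      abel
    rw [e4, smul_smul, e3, one_smul]
  rw [hS, norm_smul, Complex.norm_real, Real.norm_of_nonneg (Real.exp_pos 1).le]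
  gcongr
  exact (norm_sub_le _ _).trans (add_le_add hqn ((norm_add_le _ _).trans (add_le_add e1 e2)))

end C0Semigroup

/-! ### Convolution with a function whose transform is locally one -/

section Convolution

open scoped FourierTransform SchwartzMap

variable {Ω : Type*} [MeasurableSpace Ω]

theorem fourierFun_eq_fourierDensity (g : ℝ → ℂ) :
    fourierFun g = fourierDensity volume (fun t => t) g := by
  ext ξ
  simp only [fourierFun, fourierDensity, mul_comm]

theorem integrable_density_mul_comp_sub {m : Measure Ω} [SFinite m] {r : Ω → ℝ}
    (hr : Measurable r) {h : Ω → ℂ} (hh : Integrable h m) {ψ : ℝ → ℂ} (hψc : Continuous ψ)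
    (hψ : Integrable ψ) :
    Integrable (Function.uncurry fun (ω : Ω) (t : ℝ) => h ω * ψ (t - r ω)) (m.prod volume) := by
  have hmeas : AEStronglyMeasurable (Function.uncurry fun (ω : Ω) (t : ℝ) => h ω * ψ (t - r ω))
      (m.prod volume) := by
    refine hh.1.comp_fst.mul (hψc.comp_aestronglyMeasurable ?_)
    exact Measurable.aestronglyMeasurable (by fun_prop)
  refine (integrable_prod_iff hmeas).2 ⟨Eventually.of_forall fun ω => ?_, ?_⟩
  · exact (hψ.comp_sub_right (r ω)).const_mul (h ω)
  · have : ∀ ω, ∫ t, ‖h ω * ψ (t - r ω)‖ = ‖h ω‖ * ∫ t, ‖ψ t‖ := by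
      intro ω
      simp only [norm_mul]
      rw [integral_const_mul, integral_sub_right_eq_self (fun t => ‖ψ t‖) (r ω)]
    simp only [Function.uncurry, this]
    exact hh.norm.mul_const _

theorem fourierFun_integral_density_mul_comp_sub {m : Measure Ω} [SFinite m] {r : Ω → ℝ}
    (hr : Measurable r) {h : Ω → ℂ} (hh : Integrable h m) {ψ : ℝ → ℂ} (hψc : Continuous ψ)
    (hψ : Integrable ψ) (ξ : ℝ) :
    fourierFun (fun t => ∫ ω, h ω * ψ (t - r ω) ∂m) ξ =
      fourierDensity m r h ξ * fourierFun ψ ξ := by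
  have hint := integrable_density_mul_comp_sub hr hh hψc hψ
  have hint2 : Integrable (Function.uncurry fun (ω : Ω) (t : ℝ) =>
      Complex.exp (-(Complex.I * ξ * t)) * (h ω * ψ (t - r ω))) (m.prod volume) := by
    refine hint.norm.mono' ?_ (Eventually.of_forall fun p => ?_)
    · exact (Continuous.aestronglyMeasurable (f := fun t : ℝ =>
        Complex.exp (-(Complex.I * ξ * t))) (by fun_prop)).comp_snd.mul hint.1
    · simp only [Function.uncurry]
      rw [norm_mul, norm_exp_neg_I_mul_mul, one_mul]
  have e : ∀ t : ℝ, Complex.exp (-(Complex.I * ξ * t)) * ∫ ω, h ω * ψ (t - r ω) ∂m =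
      ∫ ω, Complex.exp (-(Complex.I * ξ * t)) * (h ω * ψ (t - r ω)) ∂m :=
    fun t => (integral_const_mul _ _).symm
  simp only [fourierFun, fourierDensity, e]
  rw [← integral_integral_swap hint2, ← integral_mul_const]
  congr with ω
  rw [← integral_const_mul, ← integral_add_right_eq_self _ (r ω)]
  congr with t
  rw [add_sub_cancel_right, Complex.ofReal_add, mul_add, neg_add, Complex.exp_add]
  ring

/-- Integrable functions whose Fourier transform is `1` on a given bounded interval. -/
theorem exists_fourierFun_eq_one (R : ℝ) :
    ∃ ψ : ℝ → ℂ, Continuous ψ ∧ Integrable ψ ∧ ∀ ξ : ℝ, |ξ| < R → fourierFun ψ ξ = 1 := by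
  have hpi := Real.pi_pos
  -- The bump needs a positive inner radius. Since `fourierFun` at `ξ` is `𝓕` at `ξ/(2π)` and `2π >
  -- 1`, radius `ρ ≥ R` is ample.
  set ρ : ℝ := max R 1
  have hρ : 0 < ρ := lt_max_of_lt_right one_pos
  let χ : ContDiffBump (0 : ℝ) := ⟨ρ, ρ + 1, hρ, by linarith⟩
  have hc1 : HasCompactSupport (Complex.ofRealCLM ∘ χ) := χ.hasCompactSupport.comp_left rfl
  have hc2 : ContDiff ℝ ((⊤ : ℕ∞) : WithTop ℕ∞) (Complex.ofRealCLM ∘ χ) :=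
    Complex.ofRealCLM.contDiff.comp χ.contDiff
  set G : 𝓢(ℝ, ℂ) := hc1.toSchwartzMap hc2 with hG
  have hGa : ∀ w : ℝ, |w| ≤ ρ → G w = 1 := by
    intro w hw
    have h1 : χ w = 1 := χ.one_of_mem_closedBall (by simpa using hw)
    have h2 : G w = ((χ w : ℝ) : ℂ) := rfl
    rw [h2, h1, Complex.ofReal_one]
  refine ⟨(𝓕⁻ G : 𝓢(ℝ, ℂ)), SchwartzMap.continuous _, SchwartzMap.integrable _, fun ξ hξ => ?_⟩
  have h1 : fourierFun (𝓕⁻ G : 𝓢(ℝ, ℂ)) ξ = 𝓕 ((𝓕⁻ G : 𝓢(ℝ, ℂ)) : ℝ → ℂ) (ξ / (2 * Real.pi)) := by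
    rw [Real.fourier_real_eq_integral_exp_smul, fourierFun]
    congr with t
    rw [smul_eq_mul]
    congr 2
    push_cast
    field_simp
  rw [h1, ← SchwartzMap.fourier_coe, FourierTransform.fourier_fourierInv_eq]
  refine hGa _ ?_
  rw [abs_div, abs_of_pos (show 0 < 2 * Real.pi by positivity), div_le_iff₀ (by positivity)]
  have : R ≤ ρ := le_max_left _ _
  nlinarith [Real.pi_gt_three]

end Convolution

/-! ### Resolvent bounds, shifted integrals and the conclusion -/

section Main

variable {X : Type*} [NormedAddCommGroup X] [NormedSpace ℂ X]

theorem norm_le_of_isResolventAt {B : X →ₗ.[ℂ] X} {z : ℂ} {R : X →L[ℂ] X}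
    (hR : IsResolventAt B z R) {x y : X} (hxy : (x, y) ∈ B.graph) :
    ‖x‖ ≤ ‖R‖ * ‖z • x - y‖ := by
  obtain ⟨x', hx', hy⟩ := (LinearPMap.mem_graph_iff B).1 hxy
  have h := hR.2 x'
  dsimp only at hx' hy
  rw [hy, hx'] at h
  calc ‖x‖ = ‖R (z • x - y)‖ := by rw [h]
    _ ≤ _ := R.le_opNorm _

/-- As `t + s ≥ 0` for `s` in the domain of `μ`, the cut-off in `shiftIntegral` is identically one
here. -/
theorem op_measureOp_eq_shiftIntegral [CompleteSpace X] (T : C0Semigroup X) (hT : T.IsBounded)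
    (μ : ComplexMeasure ℝ≥0) [IsFiniteMeasure μ.variation] {h : ℝ≥0 → ℂ}
    (hh : Integrable h μ.variation) (h1 : ∀ᵐ ω ∂μ.variation, ‖h ω‖ = 1)
    (hμ : μ.variation.withDensityᵥ h = μ) (t : ℝ≥0) (x : X) :
    T.op t (T.measureOp hT μ x) =
      T.shiftIntegral μ.variation (fun s : ℝ≥0 => (s : ℝ)) h t x := by
  obtain ⟨K, hK⟩ := id hT
  have hi := T.integrable_orbit hT μ x
  rw [C0Semigroup.measureOp_apply, integral_eq_integral_density μ hh h1 hμ _ (fun _ _ => rfl) hi,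
    ← ContinuousLinearMap.integral_comp_comm]
  · rw [C0Semigroup.shiftIntegral]
    congr with s
    have hmem : (t + s : ℝ) ∈ Set.Ici (0 : ℝ) := Set.mem_Ici.2 (by positivity)
    have e1 : expKernel 0 0 (t + s) = 1 := by
      rw [expKernel, Set.indicator_of_mem hmem]
      simp
    have e2 : T.orbit x (t + s) = T.op t (T.op s x) := by
      rw [C0Semigroup.orbit, ← NNReal.coe_add, Real.toNNReal_coe, T.op_add]
      rfl
    rw [e1, e2, map_smul, Complex.ofReal_one, one_smul]
  · refine (hh.norm.mul_const (K * ‖x‖)).mono' (hh.1.smul hi.1) (Eventually.of_forall fun s => ?_)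
    rw [norm_smul]
    gcongr
    exact (T.op s).le_of_opNorm_le (hK s) x

end Main

end KatznelsonTzafriri

theorem mainTheorem6 {X : Type*} [NormedAddCommGroup X] [InnerProductSpace ℂ X] [CompleteSpace X]
    (T : KatznelsonTzafriri.C0Semigroup X) (hT : T.IsBounded)
    (A : X →ₗ.[ℂ] X) (hA : T.generator = -A)
    (E : Set ℝ) (hE : E = {s : ℝ | ∃ z ∈ KatznelsonTzafriri.spectrum (-A), Complex.I * z = s})
    (hEc : IsCompact E) (hEs : KatznelsonTzafriri.IsOfSpectralSynthesis E)
    (η : ℝ) (hη : 0 ≤ η)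
    (hres : ∃ C : ℝ, ∀ s : ℝ, η ≤ |s| → ∃ R : X →L[ℂ] X,
      KatznelsonTzafriri.IsResolventAt (-A) (Complex.I * s) R ∧ ‖R‖ ≤ C)
    (μ : ComplexMeasure ℝ≥0) [IsFiniteMeasure μ.variation]
    (hμ : ∀ ξ ∈ E, KatznelsonTzafriri.fourierMeasure μ ξ = 0) :
    Tendsto (fun t : ℝ≥0 => ‖(T.op t).comp (T.measureOp hT μ)‖) atTop (𝓝 0) := by
  open KatznelsonTzafriri in
  obtain ⟨K, hK⟩ := id hT
  have hK0 : 0 ≤ K := (norm_nonneg _).trans (hK 0)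
  obtain ⟨C, hC⟩ := hres
  have hgraph : ∀ x y, (x, y) ∈ T.generatorGraph → (x, y) ∈ (-A).graph := by
    intro x y hxy
    rw [← hA]
    exact (T.mem_generator_graph_iff x y).2 hxy
  obtain ⟨h, hh, h1, hdens⟩ := exists_density μ
  have hr : Measurable fun s : ℝ≥0 => (s : ℝ) := NNReal.continuous_coe.measurable
  have hF : ∀ ξ, fourierMeasure μ ξ =
      fourierDensity μ.variation (fun s : ℝ≥0 => (s : ℝ)) h ξ := by
    intro ξ
    rw [fourierMeasure, integral_eq_integral_density μ hh h1 hdens (ContinuousLinearMap.mul ℝ ℂ)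
      (fun x c => mul_comm x c)]
    · rfl
    · refine Integrable.of_bound (Continuous.aestronglyMeasurable (by fun_prop)) 1
        (Eventually.of_forall fun s => ?_)
      rw [norm_exp_neg_I_mul_mul]
  -- the convolution of `μ` with a function whose Fourier transform is `1` near `E`
  obtain ⟨R, hR⟩ := hEc.isBounded.subset_ball 0
  obtain ⟨ψ, hψc, hψi, hψ⟩ := exists_fourierFun_eq_one R
  set f : ℝ → ℂ := fun t => ∫ s : ℝ≥0, h s * ψ (t - s) ∂μ.variation with hf
  have hfi : Integrable f := (integrable_density_mul_comp_sub hr hh hψc hψi).integral_prod_right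
  have hfF : ∀ ξ, fourierFun f ξ =
      fourierDensity μ.variation (fun s : ℝ≥0 => (s : ℝ)) h ξ * fourierFun ψ ξ :=
    fourierFun_integral_density_mul_comp_sub hr hh hψc hψi
  obtain ⟨g, hgi, hglim, hg⟩ := hEs.2 f hfi fun ξ hξ => by
    rw [hfF, ← hF, hμ ξ hξ, zero_mul]
  rw [Metric.tendsto_atTop']
  intro ε hε
  -- `K + 1` guards against `K = 0`; the `L¹` error will contribute at most `ε/3`.
  obtain ⟨n, hn⟩ := (hglim.eventually (Iio_mem_nhds
    (show 0 < ε / (3 * (K + 1)) by positivity))).exists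
  obtain ⟨V, hVo, hEV, hV⟩ := hg n
  -- On `V` the transform of `g n` vanishes, and on the ball that of `ψ` is one, so there `f` and
  -- `μ` have equal transforms.
  set U : Set ℝ := V ∩ Metric.ball 0 R with hUdef
  have hUo : IsOpen U := hVo.inter Metric.isOpen_ball
  have hEU : E ⊆ U := Set.subset_inter hEV hR
  obtain ⟨M, hM, a₀, ha₀, hlow⟩ := exists_uniform_lower_bound (T.generatorGraph : Set (X × X))
    (C := C) (η := η) hUo (fun ξ hξ => by
      have hξE : ξ ∉ E := fun h => hξ (hEU h)
      have hz : -(Complex.I * ξ) ∈ resolventSet (-A) := by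
        by_contra hz
        refine hξE ?_
        rw [hE]
        refine ⟨-(Complex.I * ξ), hz, ?_⟩
        rw [mul_neg, ← mul_assoc, Complex.I_mul_I]
        ring
      obtain ⟨S, hS⟩ := hz
      exact ⟨‖S‖, fun x y hxy => norm_le_of_isResolventAt hS (hgraph x y hxy)⟩)
    (fun ξ hξ x y hxy => by
      -- The transform variable `ξ` corresponds to the spectral point `-iξ`, hence the sign change.
      obtain ⟨S, hS, hSC⟩ := hC (-ξ) (by rwa [abs_neg])
      rw [Complex.ofReal_neg, mul_neg] at hS
      exact (norm_le_of_isResolventAt hS (hgraph x y hxy)).trans (by gcongr))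
  set q : ℝ → ℂ := fun t => g n t - f t with hq
  have hqi : Integrable q := (hgi n).sub hfi
  have hU : ∀ ξ ∈ U, fourierDensity μ.variation (fun s : ℝ≥0 => (s : ℝ)) h ξ +
      fourierDensity volume (fun t : ℝ => t) q ξ = 0 := by
    intro ξ hξ
    have e1 : fourierDensity volume (fun t : ℝ => t) q ξ = fourierFun (g n) ξ - fourierFun f ξ := by
      have hgen : ∀ u : ℝ → ℂ, Integrable u → Integrable fun t : ℝ =>
          u t * Complex.exp (-(Complex.I * ξ * t)) := by
        intro u hu
        refine hu.norm.mono' (hu.1.mul (Continuous.aestronglyMeasurable (by fun_prop)))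
          (Eventually.of_forall fun t => ?_)
        rw [norm_mul, norm_exp_neg_I_mul_mul, mul_one]
      rw [fourierFun_eq_fourierDensity, fourierFun_eq_fourierDensity, fourierDensity,
        fourierDensity, fourierDensity, ← integral_sub (hgen _ (hgi n)) (hgen _ hfi)]
      congr with t
      simp only [hq, sub_mul]
    have hξR : |ξ| < R := by simpa using hξ.2
    rw [e1, hV ξ hξ.1, hfF, hψ ξ hξR]
    ring
  have hev := C0Semigroup.eventually_norm_shiftIntegral_add_le hK hM.le ha₀ hlow hr hh
    measurable_id' hqi hU (show 0 < ε / 3 by positivity)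
  have hqn : ∫ t, ‖q t‖ < ε / (3 * (K + 1)) := by
    refine lt_of_eq_of_lt ?_ hn
    congr with t
    rw [hq, norm_sub_rev]
  obtain ⟨t₀, ht₀⟩ := eventually_atTop.1
    (NNReal.tendsto_coe_atTop.2 tendsto_id |>.eventually hev)
  refine ⟨t₀, fun t ht => ?_⟩
  rw [dist_zero_right, norm_norm]
  refine lt_of_le_of_lt (ContinuousLinearMap.opNorm_le_of_unit_norm
    (show 0 ≤ 2 * ε / 3 by positivity) fun x hx => ?_) (show 2 * ε / 3 < ε by linarith)
  rw [ContinuousLinearMap.comp_apply, op_measureOp_eq_shiftIntegral T hT μ hh h1 hdens]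
  have b1 := ht₀ t ht.le x hx.le
  have b2 := C0Semigroup.norm_shiftIntegral_le (r := fun t : ℝ => t) hK hqi (t : ℝ) x
  have b3 : (∫ t, ‖q t‖) * (K * ‖x‖) ≤ ε / 3 := by
    rw [hx, mul_one]
    calc (∫ t, ‖q t‖) * K ≤ ε / (3 * (K + 1)) * (K + 1) := by
          gcongr
          linarith
      _ = ε / 3 := by field_simp
  -- Subtracting the contribution of `q` from the combined integral leaves that of `μ`, at a cost of
  -- `ε/3 + ε/3`.
  have b4 := norm_sub_le (T.shiftIntegral μ.variation (fun s : ℝ≥0 => (s : ℝ)) h t x +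
    T.shiftIntegral volume (fun t : ℝ => t) q t x) (T.shiftIntegral volume (fun t : ℝ => t) q t x)
  rw [add_sub_cancel_right] at b4
  simp only [id] at b1
  linarith
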